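/- **Conventions.** Composition is written in diagrammatic order, $f⨾g$ = first $f$, then $g$. "Symmetric monoidal functor" means lax symmetric monoidal functor, with comparison arrows $F_\epsilon\colon I\to FI$ and $\widetilde F\colon FA\otimes FB\to F(A\otimes B)$. For a category $\mathsf V$ with symmetric monoidal structure, a *monoidal $\mathsf V$-category* $(\mathsf C,\boxtimes,I_{\mathsf C})$ is a $\mathsf V$-category with a $\mathsf V$-functor $\boxtimes\colon \mathsf C\otimes\mathsf C\to\mathsf C$, a unit object $I_{\mathsf C}$ and invertible $\mathsf V$-natural transformations $a_{X,Y,Z}\colon I\to\mathsf C((X\boxtimes Y)\boxtimes Z,X\boxtimes(Y\boxtimes Z))$, $l_X\colon I\to\mathsf C(I_{\mathsf C}\boxtimes X,X)$, $r_X\colon I\to \mathsf C(X\boxtimes I_{\mathsf C},X)$ satisfying the pentagon and triangle identities in the underlying category; it is *symmetric* if it is equipped with a $\mathsf V$-natural $s_{X,Y}\colon I\to\mathsf C(X\boxtimes Y,Y\boxtimes X)$ that satisfies $s_{X,Y}⨾s_{Y,X}=\mathsf{id}$, the hexagon and the unit axiom. A *nearly strict monoidal 2-category* is a (strict) 2-category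 $\mathcal B$ with a pseudofunctor $\boxtimes\colon\mathcal B\times\mathcal B\to\mathcal B$, a unit object, and strictly 2-natural, strictly invertible 1-cells $a,l,r$ satisfying the pentagon and triangle identities as equations of 1-cells. Inverting the composition constraints of $\boxtimes$ gives the *tensorators* $\vartheta_{f_1,f_2,g_1,g_2}\colon (f_1\boxtimes f_2)⨾(g_1\boxtimes g_2)\Rightarrow(f_1⨾g_1)\boxtimes(f_2⨾g_2)$. It is *symmetric* if it is equipped with a strong (pseudo-)natural transformation with 1-cell components $s_{X,Y}\colon X\boxtimes Y\to Y\boxtimes X$ satisfying $s_{X,Y}⨾s_{Y,X}=\mathsf{id}$, the hexagon and the unit axiom as equations of 1-cells. **Theorem.** Let $\mathsf V$ and $\mathsf W$ be symmetric monoidal categories, $(M,\mu,\eta,\nabla)$ a symmetric monoidal monad on $\mathsf W$ (a lax symmetric monoidal endofunctor with comparison $\nabla$ and monoidal $\mu,\eta$), $F\colon\mathsf V\to\mathsf W$ a symmetric monoidal functor, and $\mathsf U$ a full strict monoidal subcategory of $\mathsf W$, i.e. a class of objects that contains $I$, is closed under $\otimes$, and on which the associators and unitors of $\mathsf W$ are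 identities. Let $\mathrm{Kl}_M$ be the Kleisli category with its induced symmetric monoidal structure, $L_M\colon\mathsf W\to\mathrm{Kl}_M$, $f\mapsto f⨾\eta$, the canonical functor, and $\mathsf U/(-)\colon\mathrm{Kl}_M\to\mathsf{Cat}$ the partial slice functor: $\mathsf U/A$ has as objects the $\mathrm{Kl}_M$-arrows $U_1\to A$ with $U_1\in\mathsf U$ and as arrows the commuting triangles of $\mathrm{Kl}_M$-arrows; it is lax monoidal via $(f_1,f_2)\mapsto f_1\otimes f_2$ and $\mathsf{id}_I$. Put $$\mathrm{Para}\colon \mathsf V\xrightarrow{F}\mathsf W\xrightarrow{L_M}\mathrm{Kl}_M\xrightarrow{\mathsf U/(-)}\mathsf{Cat}.$$ For every $\mathsf V$-category $\mathsf C$, change of base along $\mathrm{Para}$ gives a (strict) 2-category $\mathrm{Para}_*\mathsf C$ with the following explicit description. 1. The 0-cells are the objects of $\mathsf C$. 2. The 1-cells $X\to Y$ are the $\mathrm{Kl}_M$-arrows $f\colon U_1\to F\mathsf C(X,Y)$ with $U_1\in\mathsf U$ (the parameter space of $f$). 3. The 2-cells from $f\colon U_1\to F\mathsf C(X,Y)$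 to $g\colon V_1\to F\mathsf C(X,Y)$ are the $\mathrm{Kl}_M$-arrows $\varphi\colon U_1\to V_1$ with $f=\varphi⨾g$; vertical composition and identities are those of $\mathrm{Kl}_M$. 4. The horizontal composite of $f_1\colon U_1\to F\mathsf C(X,Y)$ and $f_2\colon U_2\to F\mathsf C(Y,Z)$ is $(f_1\otimes f_2)⨾(\widetilde F⨾F(⨾_{\mathsf C})⨾\eta)\colon U_1\otimes U_2\to F\mathsf C(X,Z)$, that of 2-cells $\varphi_1,\varphi_2$ is $\varphi_1\otimes\varphi_2$, and the identity 1-cell of $X$ is $F_\epsilon⨾F(\mathsf{id}_X)⨾\eta\colon I\to F\mathsf C(X,X)$. 5. If $\mathsf C$ is a monoidal $\mathsf V$-category, then $\mathrm{Para}_*\mathsf C$ is a nearly strict monoidal 2-category. Its product is $\boxtimes$ on 0-cells, $(f_1\otimes f_2)⨾(\widetilde F⨾F(\boxtimes_{\mathsf C})⨾\eta)$ with parameter space $U_1\otimes U_2$ on 1-cells, and $\varphi_1\otimes\varphi_2$ on 2-cells; its unit is $I_{\mathsf C}$. The tensorator $\vartheta_{f_1,f_2,g_1,g_2}$, for $f_i$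 with parameter space $U_i$ and $g_i$ with parameter space $V_i$, is the image under $L_M$ of the middle-four interchange $(U_1\otimes U_2)\otimes(V_1\otimes V_2)\to(U_1\otimes V_1)\otimes(U_2\otimes V_2)$ of $\mathsf W$, and the unit constraint $\mathsf{id}_{X_1}\boxtimes\mathsf{id}_{X_2}\Rightarrow\mathsf{id}_{X_1\boxtimes X_2}$ is the identity on the parameter space $I\otimes I=I$. The 1-cells $a,l,r$ are lifted from $\mathsf C$, i.e. are $F_\epsilon⨾F(a^{\mathsf C})⨾\eta$, $F_\epsilon⨾F(l^{\mathsf C})⨾\eta$, $F_\epsilon⨾F(r^{\mathsf C})⨾\eta$, with parameter space $I$. 6. If moreover $\mathsf C$ is symmetric, then this nearly strict monoidal 2-category is symmetric, with $s_{X,Y}=F_\epsilon⨾F(s^{\mathsf C}_{X,Y})⨾\eta$; its naturality 2-cell $(f_1\boxtimes f_2)⨾s\Rightarrow s⨾(f_2\boxtimes f_1)$ is the image under $L_M$ of the swap $U_1\otimes U_2\to U_2\otimes U_1$ of the parameter spaces. -/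

import Mathlib

open CategoryTheory MonoidalCategory Functor.LaxMonoidal
universe v u v₁ u₁ w w₁ w₂ v₂ u₂ w₃ v₃ u₃ w₄ v₄ u₄
attribute [-instance] CategoryTheory.catToReflQuiver

namespace ParaUncertainty
variable {W : Type u} [Category.{v} W] [MonoidalCategory W] [SymmetricCategory W]
  (M : Monad W) [M.toFunctor.LaxBraided] [NatTrans.IsMonoidal M.η] [NatTrans.IsMonoidal M.μ]

/-- The canonical functor `L_M : W ⥤ Kl_M`, `f ↦ f ⨾ η`. -/
abbrev toKl {W : Type u} [Category.{v} W] (M : Monad W) : W ⥤ Kleisli M where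
  obj X := .mk M X
  map {X Y} f := .mk (f ≫ M.η.app Y)
  map_id X := (Kleisli.Adjunction.toKleisli M).map_id X
  map_comp f g := (Kleisli.Adjunction.toKleisli M).map_comp f g

theorem toKl_eq {W : Type u} [Category.{v} W] (M : Monad W) :
    toKl M = Kleisli.Adjunction.toKleisli M := rfl

variable {M}

theorem monad_unit_tensor (X Y : W) :
    (M.η.app X ⊗ₘ M.η.app Y) ≫ μ M.toFunctor X Y = M.η.app (X ⊗ Y) := by
  have := NatTrans.IsMonoidal.tensor (τ := M.η) X Y
  simpa using this.symm

theorem monad_unit_unit : ε M.toFunctor = M.η.app (𝟙_ W) := by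
  have := NatTrans.IsMonoidal.unit (τ := M.η)
  simpa using this.symm

theorem monad_mul_tensor (X Y : W) :
    μ M.toFunctor (M.obj X) (M.obj Y) ≫ M.map (μ M.toFunctor X Y) ≫ M.μ.app (X ⊗ Y) =
      (M.μ.app X ⊗ₘ M.μ.app Y) ≫ μ M.toFunctor X Y := by
  have := NatTrans.IsMonoidal.tensor (τ := M.μ) X Y
  simpa using this

/-- The monoidal structure of the Kleisli category: `f ⊗ g` is `(f ⊗ g) ⨾ ∇`, and the coherence
isomorphisms are the images under `L_M` of those of `W`. -/
instance kleisliStruct : MonoidalCategoryStruct (Kleisli M) where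
  tensorObj X Y := .mk M (X.of ⊗ Y.of)
  tensorUnit := .mk M (𝟙_ W)
  tensorHom f g := .mk ((f.of ⊗ₘ g.of) ≫ μ M.toFunctor _ _)
  whiskerLeft X _ _ f := .mk ((M.η.app X.of ⊗ₘ f.of) ≫ μ M.toFunctor _ _)
  whiskerRight f Y := .mk ((f.of ⊗ₘ M.η.app Y.of) ≫ μ M.toFunctor _ _)
  associator X Y Z := (toKl M).mapIso (α_ X.of Y.of Z.of)
  leftUnitor X := (toKl M).mapIso (λ_ X.of)
  rightUnitor X := (toKl M).mapIso (ρ_ X.of)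

theorem kl_comp_toKl {X : Kleisli M} {Y Z : W} (f : X ⟶ (toKl M).obj Y) (g : Y ⟶ Z) :
    (f ≫ (toKl M).map g).of = f.of ≫ M.map g := by
  change f.of ≫ M.map (g ≫ M.η.app Z) ≫ M.μ.app Z = _
  rw [M.map_comp, Category.assoc, M.right_unit]
  exact congrArg _ (Category.comp_id _)

theorem toKl_comp_kl {X Y : W} {Z : Kleisli M} (f : X ⟶ Y) (g : (toKl M).obj Y ⟶ Z) :
    ((toKl M).map f ≫ g).of = f ≫ g.of := by
  change (f ≫ M.η.app Y) ≫ M.map g.of ≫ M.μ.app Z.of = _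
  have h : M.η.app Y ≫ M.map g.of = g.of ≫ M.η.app (M.obj Z.of) := (M.η.naturality g.of).symm
  rw [Category.assoc, reassoc_of% h, M.left_unit]
  exact congrArg _ (Category.comp_id _)

theorem toKl_tensor {X₁ X₂ Y₁ Y₂ : W} (f : X₁ ⟶ Y₁) (g : X₂ ⟶ Y₂) :
    MonoidalCategoryStruct.tensorHom ((toKl M).map f) ((toKl M).map g) =
      (toKl M).map (f ⊗ₘ g) := by
  apply Kleisli.hom_ext
  change ((f ≫ M.η.app Y₁) ⊗ₘ (g ≫ M.η.app Y₂)) ≫ μ M.toFunctor _ _ = (f ⊗ₘ g) ≫ M.η.app _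
  rw [← monad_unit_tensor, tensorHom_comp_tensorHom_assoc]

instance kleisliMonoidal : MonoidalCategory (Kleisli M) :=
  .ofTensorHom
  (id_tensorHom_id := fun X Y => by
    apply Kleisli.hom_ext
    exact monad_unit_tensor _ _)
  (id_tensorHom := fun _ _ _ _ => rfl)
  (tensorHom_id := fun _ _ => rfl)
  (tensorHom_comp_tensorHom := fun {X₁ Y₁ Z₁ X₂ Y₂ Z₂} f₁ f₂ g₁ g₂ => by
    apply Kleisli.hom_ext
    change ((f₁.of ⊗ₘ f₂.of) ≫ μ M.toFunctor _ _) ≫ M.map ((g₁.of ⊗ₘ g₂.of) ≫ μ M.toFunctor _ _) ≫ 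
       M.μ.app _ = ((f₁.of ≫ M.map g₁.of ≫ M.μ.app _) ⊗ₘ (f₂.of ≫ M.map g₂.of ≫ M.μ.app _)) ≫ μ M.toFunctor _ _
    simp only [M.map_comp, Category.assoc]
    rw [← μ_natural_assoc, monad_mul_tensor]
    simp only [tensorHom_comp_tensorHom_assoc])
  (associator_naturality := fun {X₁ X₂ X₃ Y₁ Y₂ Y₃} f₁ f₂ f₃ => by
    apply Kleisli.hom_ext
    refine (kl_comp_toKl _ _).trans (Eq.trans ?_ (toKl_comp_kl _ _).symm)
    change ((((f₁.of ⊗ₘ f₂.of) ≫ μ M.toFunctor _ _) ⊗ₘ f₃.of) ≫ μ M.toFunctor _ _) ≫ M.map (α_ _ _ _).hom =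
      (α_ _ _ _).hom ≫ (f₁.of ⊗ₘ ((f₂.of ⊗ₘ f₃.of) ≫ μ M.toFunctor _ _)) ≫ μ M.toFunctor _ _
    have h := associativity M.toFunctor Y₁.of Y₂.of Y₃.of
    rw [← Category.comp_id f₃.of, ← tensorHom_comp_tensorHom, Category.assoc, Category.assoc, tensorHom_id, h,
      associator_naturality_assoc, ← Category.comp_id f₁.of, ← tensorHom_comp_tensorHom, id_tensorHom]
    simp only [Category.comp_id, Category.assoc])
  (leftUnitor_naturality := fun {X Y} f => by
    apply Kleisli.hom_ext
    refine (kl_comp_toKl _ _).trans (Eq.trans ?_ (toKl_comp_kl _ _).symm)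
    change ((M.η.app (𝟙_ W) ⊗ₘ f.of) ≫ μ M.toFunctor _ _) ≫ M.map (λ_ _).hom = (λ_ _).hom ≫ f.of
    rw [← leftUnitor_naturality, left_unitality M.toFunctor, monad_unit_unit, ← Category.assoc, ← Category.assoc, MonoidalCategory.tensorHom_def']
    rfl)
  (rightUnitor_naturality := fun {X Y} f => by
    apply Kleisli.hom_ext
    refine (kl_comp_toKl _ _).trans (Eq.trans ?_ (toKl_comp_kl _ _).symm)
    change ((f.of ⊗ₘ M.η.app (𝟙_ W)) ≫ μ M.toFunctor _ _) ≫ M.map (ρ_ _).hom = (ρ_ _).hom ≫ f.of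
    rw [← rightUnitor_naturality, right_unitality M.toFunctor, monad_unit_unit, ← Category.assoc, ← Category.assoc, MonoidalCategory.tensorHom_def]
    rfl)
  (pentagon := fun X₁ X₂ X₃ X₄ => by
    have h := congrArg (toKl M).map (MonoidalCategory.pentagon X₁.of X₂.of X₃.of X₄.of)
    rw [← tensorHom_id, ← id_tensorHom, (toKl M).map_comp, (toKl M).map_comp, (toKl M).map_comp,
      ← toKl_tensor, ← toKl_tensor, (toKl M).map_id, (toKl M).map_id] at h
    exact h)
  (triangle := fun X Y => by
    have h := congrArg (toKl M).map (MonoidalCategory.triangle X.of Y.of)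
    rw [← tensorHom_id, ← id_tensorHom, (toKl M).map_comp,
      ← toKl_tensor, ← toKl_tensor, (toKl M).map_id, (toKl M).map_id] at h
    exact h)

instance kleisliBraided : BraidedCategory (Kleisli M) where
  braiding X Y := (toKl M).mapIso (β_ X.of Y.of)
  braiding_naturality_right X Y Z f := by
    apply Kleisli.hom_ext
    refine (kl_comp_toKl _ _).trans (Eq.trans ?_ (toKl_comp_kl _ _).symm)
    change ((M.η.app X.of ⊗ₘ f.of) ≫ μ M.toFunctor _ _) ≫ M.map (β_ _ _).hom =
      (β_ _ _).hom ≫ (f.of ⊗ₘ M.η.app X.of) ≫ μ M.toFunctor _ _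
    have h := BraidedCategory.braiding_naturality_assoc (M.η.app X.of) f.of (μ M.toFunctor _ _)
    rw [Category.assoc, Functor.LaxBraided.braided, h]
  braiding_naturality_left f Z := by
    apply Kleisli.hom_ext
    refine (kl_comp_toKl _ _).trans (Eq.trans ?_ (toKl_comp_kl _ _).symm)
    change ((f.of ⊗ₘ M.η.app Z.of) ≫ μ M.toFunctor _ _) ≫ M.map (β_ _ _).hom =
      (β_ _ _).hom ≫ (M.η.app Z.of ⊗ₘ f.of) ≫ μ M.toFunctor _ _
    have h := BraidedCategory.braiding_naturality_assoc f.of (M.η.app Z.of) (μ M.toFunctor _ _)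
    rw [Category.assoc, Functor.LaxBraided.braided, h]
  hexagon_forward X Y Z := by
    have h := congrArg (toKl M).map (BraidedCategory.hexagon_forward X.of Y.of Z.of)
    rw [← tensorHom_id, ← id_tensorHom, (toKl M).map_comp, (toKl M).map_comp, (toKl M).map_comp,
      (toKl M).map_comp, ← toKl_tensor, ← toKl_tensor, (toKl M).map_id, (toKl M).map_id] at h
    exact h
  hexagon_reverse X Y Z := by
    have h := congrArg (toKl M).map (BraidedCategory.hexagon_reverse X.of Y.of Z.of)
    rw [← tensorHom_id, ← id_tensorHom, (toKl M).map_comp, (toKl M).map_comp, (toKl M).map_comp,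
      (toKl M).map_comp, ← toKl_tensor, ← toKl_tensor, (toKl M).map_id, (toKl M).map_id] at h
    exact h

instance kleisliSymmetric : SymmetricCategory (Kleisli M) where
  symmetry X Y := by
    change (toKl M).map (β_ _ _).hom ≫ (toKl M).map (β_ _ _).hom = _
    rw [← CategoryTheory.Functor.map_comp, SymmetricCategory.symmetry, CategoryTheory.Functor.map_id]
    rfl

/-- `L_M` is a strict symmetric monoidal functor. -/
instance toKlBraided : (toKl M).LaxBraided where
  ε := 𝟙 _
  μ X Y := 𝟙 _
  μ_natural_left f X := by
    rw [Category.comp_id, Category.id_comp, ← tensorHom_id, ← tensorHom_id,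
      ← toKl_tensor, CategoryTheory.Functor.map_id]
  μ_natural_right X f := by
    rw [Category.comp_id, Category.id_comp, ← id_tensorHom, ← id_tensorHom,
      ← toKl_tensor, CategoryTheory.Functor.map_id]
  associativity X Y Z := by
    rw [id_whiskerRight, MonoidalCategory.whiskerLeft_id]
    simp only [Category.id_comp, Category.comp_id]
    rfl
  left_unitality X := by
    rw [id_whiskerRight]
    simp only [Category.id_comp]
    rfl
  right_unitality X := by
    rw [MonoidalCategory.whiskerLeft_id]
    simp only [Category.id_comp]
    rfl
  braided X Y := by
    rw [Category.comp_id, Category.id_comp]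
    rfl


section slice

/-- The full subcategory of `Kl_M` on the objects of `U`. -/
abbrev klSub {W : Type u} [Category.{v} W] (M : Monad W) (P : ObjectProperty W) : ObjectProperty (Kleisli M) := fun X => P X.of

/-- The partial slice functor `U/(-) : Kl_M ⥤ Cat`: objects of `U/A` are pairs of an object `U₁` of
`U` and an arrow `U₁ ⟶ A` of `Kl_M`, and arrows are commuting triangles. -/
abbrev partialSlice {W : Type u} [Category.{v} W] (M : Monad W) (P : ObjectProperty W) : Kleisli M ⥤ Cat.{v, max u v} := CostructuredArrow.functor (klSub M P).ι

/-- The full subcategory of `W` on the objects satisfying `P` is a strict monoidal subcategory: it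
contains the unit, is closed under `⊗`, and the associators and unitors of its objects are
identities. -/
class IsStrictMonoidalSub (P : ObjectProperty W) : Prop extends P.IsMonoidal where
  assoc (X Y Z : W) : P X → P Y → P Z → ∃ h : (X ⊗ Y) ⊗ Z = X ⊗ (Y ⊗ Z), (α_ X Y Z).hom = eqToHom h
  left (X : W) : P X → ∃ h : 𝟙_ W ⊗ X = X, (λ_ X).hom = eqToHom h
  right (X : W) : P X → ∃ h : X ⊗ 𝟙_ W = X, (ρ_ X).hom = eqToHom h

theorem slice_functor_ext {D : Type*} [Category D] {M : Monad W} {P : ObjectProperty W}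
    {A : Kleisli M} {F G : D ⥤ CostructuredArrow (klSub M P).ι A}
    (e : ∀ x, (F.obj x).left.obj ⟶ (G.obj x).left.obj)
    (he : ∀ x, ∃ h : (F.obj x).left.obj = (G.obj x).left.obj, e x = eqToHom h)
    (hh : ∀ x, (F.obj x).hom = e x ≫ (G.obj x).hom)
    (hm : ∀ x y (f : x ⟶ y), (F.map f).left.hom ≫ e y = e x ≫ (G.map f).left.hom) :
    F = G := by
  have key (X Y : (klSub M P).FullSubcategory) (h : X = Y) (h' : X.obj = Y.obj) :
      (eqToHom h).hom = eqToHom h' := by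
    subst h; rfl
  have hl : ∀ x, (F.obj x).left = (G.obj x).left := fun x => by
    have := (he x).choose
    generalize (F.obj x).left = a at *
    generalize (G.obj x).left = b at *
    cases a; cases b; cases this; rfl
  have hk : ∀ x (h : (F.obj x).left = (G.obj x).left), (eqToHom h).hom = e x := fun x h =>
    (key _ _ h (he x).choose).trans (he x).choose_spec.symm
  have ho : ∀ x, F.obj x = G.obj x := fun x =>
    CostructuredArrow.obj_ext _ _ (hl x) (by
      rw [hh x]
      exact congrArg (· ≫ (G.obj x).hom) (hk x (hl x)))
  refine CategoryTheory.Functor.ext ho fun x y f => ?_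
  rw [← Category.assoc, eq_comm, comp_eqToHom_iff, eq_comm]
  apply CostructuredArrow.hom_ext
  apply ObjectProperty.hom_ext
  refine Eq.trans ?_ ((hm x y f).trans ?_)
  · refine congrArg ((F.map f).left.hom ≫ ·) ?_
    rw [CostructuredArrow.eqToHom_left]
    exact hk _ _
  · refine congrArg (· ≫ (G.map f).left.hom) ?_
    rw [CostructuredArrow.eqToHom_left]
    exact (hk _ _).symm

variable (M) (P : ObjectProperty W) [P.IsMonoidal]

/-- The comparison functor `U/A × U/B ⥤ U/(A ⊗ B)`, `(f₁, f₂) ↦ f₁ ⊗ f₂`. -/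
def sliceμ (A B : Kleisli M) : CostructuredArrow (klSub M P).ι A × CostructuredArrow (klSub M P).ι B ⥤ CostructuredArrow (klSub M P).ι (A ⊗ B) where
  obj x := CostructuredArrow.mk (S := (klSub M P).ι) (Y := (⟨x.1.left.obj ⊗ x.2.left.obj, P.prop_tensor x.1.left.property x.2.left.property⟩ : (klSub M P).FullSubcategory)) (x.1.hom ⊗ₘ x.2.hom)
  map {x y} φ := CostructuredArrow.homMk (ObjectProperty.homMk (φ.1.left.hom ⊗ₘ φ.2.left.hom)) (by
     have h1 : φ.1.left.hom ≫ y.1.hom = x.1.hom := CostructuredArrow.w φ.1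
     have h2 : φ.2.left.hom ≫ y.2.hom = x.2.hom := CostructuredArrow.w φ.2
     change (φ.1.left.hom ⊗ₘ φ.2.left.hom) ≫ (y.1.hom ⊗ₘ y.2.hom) = (x.1.hom ⊗ₘ x.2.hom)
     rw [← h1, ← h2]
     exact tensorHom_comp_tensorHom _ _ _ _)
  map_id x := by
    apply CostructuredArrow.hom_ext
    apply ObjectProperty.hom_ext
    exact id_tensorHom_id _ _
  map_comp f g := by
    apply CostructuredArrow.hom_ext
    apply ObjectProperty.hom_ext
    exact (tensorHom_comp_tensorHom _ _ _ _).symm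

/-- The comparison functor `1 ⥤ U/I` picking out `𝟙 I`. -/
def sliceε : Cat.chosenTerminal.{v, max u v} ⥤ CostructuredArrow (klSub M P).ι (𝟙_ (Kleisli M)) :=
  (Functor.const _).obj (CostructuredArrow.mk (S := (klSub M P).ι) (Y := (⟨𝟙_ (Kleisli M), P.prop_unit⟩ : (klSub M P).FullSubcategory)) (𝟙 (𝟙_ (Kleisli M))))

end slice

section
variable (M) (P : ObjectProperty W) [IsStrictMonoidalSub P]

theorem kl_assoc (X Y Z : Kleisli M) (hX : P X.of) (hY : P Y.of) (hZ : P Z.of) :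
    ∃ h : (X ⊗ Y) ⊗ Z = X ⊗ (Y ⊗ Z), (α_ X Y Z).hom = eqToHom h := by
  obtain ⟨h, e⟩ := IsStrictMonoidalSub.assoc X.of Y.of Z.of hX hY hZ
  refine ⟨congrArg (Kleisli.mk M) h, ?_⟩
  change (toKl M).map (α_ X.of Y.of Z.of).hom = _
  rw [e, eqToHom_map]

theorem kl_left (X : Kleisli M) (hX : P X.of) :
    ∃ h : 𝟙_ (Kleisli M) ⊗ X = X, (λ_ X).hom = eqToHom h := by
  obtain ⟨h, e⟩ := IsStrictMonoidalSub.left X.of hX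
  refine ⟨congrArg (Kleisli.mk M) h, ?_⟩
  change (toKl M).map (λ_ X.of).hom = _
  rw [e, eqToHom_map]

theorem kl_right (X : Kleisli M) (hX : P X.of) :
    ∃ h : X ⊗ 𝟙_ (Kleisli M) = X, (ρ_ X).hom = eqToHom h := by
  obtain ⟨h, e⟩ := IsStrictMonoidalSub.right X.of hX
  refine ⟨congrArg (Kleisli.mk M) h, ?_⟩
  change (toKl M).map (ρ_ X.of).hom = _
  rw [e, eqToHom_map]

instance partialSliceLax : (partialSlice M P).LaxMonoidal where
  ε := (sliceε M P).toCatHom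
  μ A B := (sliceμ M P A B).toCatHom
  μ_natural_left {A B} f A' := by
    apply Cat.Hom.ext
    refine slice_functor_ext (fun x => 𝟙 _) (fun x => ⟨rfl, rfl⟩) (fun x => ?_) (fun x y f => ?_)
    · refine Eq.trans ?_ (Category.id_comp _).symm
      refine Eq.trans ?_ (congrArg ((x.1.hom ⊗ₘ x.2.hom) ≫ ·) (tensorHom_id f A'))
      exact ((tensorHom_comp_tensorHom x.1.hom x.2.hom f (𝟙 A')).trans
        (congrArg (fun k : _ ⟶ A' => (x.1.hom ≫ f) ⊗ₘ k) (Category.comp_id x.2.hom))).symm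
    · exact (Category.comp_id _).trans (Category.id_comp _).symm
  μ_natural_right {A B} A' f := by
    apply Cat.Hom.ext
    refine slice_functor_ext (fun x => 𝟙 _) (fun x => ⟨rfl, rfl⟩) (fun x => ?_) (fun x y f => ?_)
    · refine Eq.trans ?_ (Category.id_comp _).symm
      refine Eq.trans ?_ (congrArg ((x.1.hom ⊗ₘ x.2.hom) ≫ ·) (id_tensorHom A' f))
      exact ((tensorHom_comp_tensorHom x.1.hom x.2.hom (𝟙 A') f).trans
        (congrArg (fun k : _ ⟶ A' => k ⊗ₘ (x.2.hom ≫ f)) (Category.comp_id x.1.hom))).symm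
    · exact (Category.comp_id _).trans (Category.id_comp _).symm
  associativity A B C := by
    apply Cat.Hom.ext
    refine slice_functor_ext
      (fun x => (α_ x.1.1.left.obj x.1.2.left.obj x.2.left.obj).hom)
      (fun x => kl_assoc M P _ _ _ x.1.1.left.property x.1.2.left.property x.2.left.property)
      (fun x => ?_) (fun x y f => ?_)
    · exact associator_naturality x.1.1.hom x.1.2.hom x.2.hom
    · exact associator_naturality f.1.1.left.hom f.1.2.left.hom f.2.left.hom
  left_unitality A := by
    symm
    apply Cat.Hom.ext
    refine slice_functor_ext (fun x => (λ_ x.2.left.obj).hom)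
      (fun x => kl_left M P _ x.2.left.property) (fun x => ?_) (fun x y f => ?_)
    · exact (congrArg (· ≫ (λ_ A).hom) (id_tensorHom (𝟙_ (Kleisli M)) x.2.hom)).trans
        (leftUnitor_naturality x.2.hom)
    · exact (congrArg (· ≫ (λ_ y.2.left.obj).hom)
        (id_tensorHom (𝟙_ (Kleisli M)) f.2.left.hom)).trans (leftUnitor_naturality f.2.left.hom)
  right_unitality A := by
    symm
    apply Cat.Hom.ext
    refine slice_functor_ext (fun x => (ρ_ x.1.left.obj).hom)
      (fun x => kl_right M P _ x.1.left.property) (fun x => ?_) (fun x y f => ?_)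
    · exact (congrArg (· ≫ (ρ_ A).hom) (tensorHom_id x.1.hom (𝟙_ (Kleisli M)))).trans
        (rightUnitor_naturality x.1.hom)
    · exact (congrArg (· ≫ (ρ_ y.1.left.obj).hom)
        (tensorHom_id f.1.left.hom (𝟙_ (Kleisli M)))).trans (rightUnitor_naturality f.1.left.hom)

end

section enriched

variable {V : Type u₁} [Category.{v₁} V] [MonoidalCategory V] [SymmetricCategory V]

/-- Composition in the underlying ordinary category `C₀`, whose arrows are points `I ⟶ C(X, Y)`. -/
abbrev comp0 {C : Type w} [EnrichedCategory V C] {X Y Z : C}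
    (f : 𝟙_ V ⟶ (X ⟶[V] Y)) (g : 𝟙_ V ⟶ (Y ⟶[V] Z)) : 𝟙_ V ⟶ (X ⟶[V] Z) :=
  (λ_ (𝟙_ V)).inv ≫ (f ⊗ₘ g) ≫ eComp V X Y Z

/-- Invertibility in `C₀`. -/
abbrev IsIso0 {C : Type w} [EnrichedCategory V C] {X Y : C} (f : 𝟙_ V ⟶ (X ⟶[V] Y)) : Prop :=
  ∃ g : 𝟙_ V ⟶ (Y ⟶[V] X), comp0 f g = eId V X ∧ comp0 g f = eId V Y

/-- One `V`-naturality square, for points `t : X ⟶ X'` and `t' : Y ⟶ Y'`, where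
`Φ : D ⟶ C(X, Y)` and `Ψ : D ⟶ C(X', Y')` are the actions on a hom-object `D` of the two
`V`-functors: `t ⨾ Ψ(-) = Φ(-) ⨾ t'` as arrows `D ⟶ C(X, Y')`. -/
abbrev VNaturalAt {C : Type w} [EnrichedCategory V C] {D : V} {X X' Y Y' : C}
    (Φ : D ⟶ (X ⟶[V] Y)) (Ψ : D ⟶ (X' ⟶[V] Y'))
    (t : 𝟙_ V ⟶ (X ⟶[V] X')) (t' : 𝟙_ V ⟶ (Y ⟶[V] Y')) : Prop :=
  (λ_ D).inv ≫ (t ⊗ₘ Ψ) ≫ eComp V X X' Y' = (ρ_ D).inv ≫ (Φ ⊗ₘ t') ≫ eComp V X Y Y'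

variable (V) in
/-- The structure of a monoidal `V`-category on a `V`-category `C`: a `V`-functor
`⊠ : C ⊗ C ⟶ C`, a unit object, and invertible `V`-natural associator and unitors satisfying the
pentagon and triangle identities. -/
structure MonoidalVCat (C : Type w) [EnrichedCategory V C] where
  /-- The product `X ⊠ Y` of objects. -/
  tensor : C → C → C
  /-- The unit object. -/
  unit : C
  /-- The action of `⊠` on hom-objects. -/
  tensorHom (X₁ Y₁ X₂ Y₂ : C) :
    (X₁ ⟶[V] Y₁) ⊗ (X₂ ⟶[V] Y₂) ⟶ (tensor X₁ X₂ ⟶[V] tensor Y₁ Y₂)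
  tensorHom_id (X₁ X₂ : C) :
    (λ_ (𝟙_ V)).inv ≫ (eId V X₁ ⊗ₘ eId V X₂) ≫ tensorHom X₁ X₁ X₂ X₂ = eId V (tensor X₁ X₂)
  tensorHom_comp (X₁ Y₁ Z₁ X₂ Y₂ Z₂ : C) :
    tensorμ (X₁ ⟶[V] Y₁) (Y₁ ⟶[V] Z₁) (X₂ ⟶[V] Y₂) (Y₂ ⟶[V] Z₂) ≫
        (tensorHom X₁ Y₁ X₂ Y₂ ⊗ₘ tensorHom Y₁ Z₁ Y₂ Z₂) ≫ eComp V _ _ _ =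
      (eComp V X₁ Y₁ Z₁ ⊗ₘ eComp V X₂ Y₂ Z₂) ≫ tensorHom X₁ Z₁ X₂ Z₂
  /-- The associator. -/
  a (X Y Z : C) : 𝟙_ V ⟶ (tensor (tensor X Y) Z ⟶[V] tensor X (tensor Y Z))
  /-- The left unitor. -/
  l (X : C) : 𝟙_ V ⟶ (tensor unit X ⟶[V] X)
  /-- The right unitor. -/
  r (X : C) : 𝟙_ V ⟶ (tensor X unit ⟶[V] X)
  a_iso (X Y Z : C) : IsIso0 (a X Y Z)
  l_iso (X : C) : IsIso0 (l X)
  r_iso (X : C) : IsIso0 (r X)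
  a_natural (X₁ Y₁ X₂ Y₂ X₃ Y₃ : C) :
    VNaturalAt (D := ((X₁ ⟶[V] Y₁) ⊗ (X₂ ⟶[V] Y₂)) ⊗ (X₃ ⟶[V] Y₃))
      (tensorHom X₁ Y₁ X₂ Y₂ ▷ _ ≫ tensorHom _ _ X₃ Y₃)
      ((α_ _ _ _).hom ≫ _ ◁ tensorHom X₂ Y₂ X₃ Y₃ ≫ tensorHom X₁ Y₁ _ _)
      (a X₁ X₂ X₃) (a Y₁ Y₂ Y₃)
  l_natural (X Y : C) :
    VNaturalAt (D := (X ⟶[V] Y)) ((λ_ _).inv ≫ eId V unit ▷ _ ≫ tensorHom unit unit X Y) (𝟙 _)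
      (l X) (l Y)
  r_natural (X Y : C) :
    VNaturalAt (D := (X ⟶[V] Y)) ((ρ_ _).inv ≫ _ ◁ eId V unit ≫ tensorHom X Y unit unit) (𝟙 _)
      (r X) (r Y)
  pentagon (A B D E : C) :
    comp0 ((λ_ (𝟙_ V)).inv ≫ (a A B D ⊗ₘ eId V E) ≫ tensorHom _ _ _ _)
        (comp0 (a A (tensor B D) E)
          ((λ_ (𝟙_ V)).inv ≫ (eId V A ⊗ₘ a B D E) ≫ tensorHom _ _ _ _)) =
      comp0 (a (tensor A B) D E) (a A B (tensor D E))
  triangle (A B : C) :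
    comp0 (a A unit B) ((λ_ (𝟙_ V)).inv ≫ (eId V A ⊗ₘ l B) ≫ tensorHom _ _ _ _) =
      (λ_ (𝟙_ V)).inv ≫ (r A ⊗ₘ eId V B) ≫ tensorHom _ _ _ _

/-- A symmetry on a monoidal `V`-category. -/
structure SymmetryVCat {C : Type w} [EnrichedCategory V C] (𝓜 : MonoidalVCat V C) where
  /-- The symmetry. -/
  s (X Y : C) : 𝟙_ V ⟶ (𝓜.tensor X Y ⟶[V] 𝓜.tensor Y X)
  s_natural (X₁ Y₁ X₂ Y₂ : C) :
    VNaturalAt (𝓜.tensorHom X₁ Y₁ X₂ Y₂) ((β_ _ _).hom ≫ 𝓜.tensorHom X₂ Y₂ X₁ Y₁)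
      (s X₁ X₂) (s Y₁ Y₂)
  s_comp_s (X Y : C) : comp0 (s X Y) (s Y X) = eId V (𝓜.tensor X Y)
  hexagon (A B D : C) :
    comp0 (𝓜.a A B D) (comp0 (s A (𝓜.tensor B D)) (𝓜.a B D A)) =
      comp0 ((λ_ (𝟙_ V)).inv ≫ (s A B ⊗ₘ eId V D) ≫ 𝓜.tensorHom _ _ _ _)
        (comp0 (𝓜.a B A D) ((λ_ (𝟙_ V)).inv ≫ (eId V B ⊗ₘ s A D) ≫ 𝓜.tensorHom _ _ _ _))
  s_unit (A : C) : comp0 (s A 𝓜.unit) (𝓜.l A) = 𝓜.r A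

end enriched

section nearly
open Bicategory

/-- The constraint data completing an action `T` on 0-, 1- and 2-cells to a pseudofunctor. -/
structure PseudoExt {A : Type u₂} [Bicategory.{w₂, v₂} A] {B : Type u₃} [Bicategory.{w₃, v₃} B]
    (T : PrelaxFunctor A B) where
  /-- The unit constraint. -/
  mapId (a : A) : T.map (𝟙 a) ≅ 𝟙 (T.obj a)
  /-- The composition constraint. -/
  mapComp {a b c : A} (f : a ⟶ b) (g : b ⟶ c) : T.map (f ≫ g) ≅ T.map f ≫ T.map g
  map₂_whisker_left {a b c : A} (f : a ⟶ b) {g h : b ⟶ c} (η : g ⟶ h) :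
    T.map₂ (f ◁ η) = (mapComp f g).hom ≫ T.map f ◁ T.map₂ η ≫ (mapComp f h).inv
  map₂_whisker_right {a b c : A} {f g : a ⟶ b} (η : f ⟶ g) (h : b ⟶ c) :
    T.map₂ (η ▷ h) = (mapComp f h).hom ≫ T.map₂ η ▷ T.map h ≫ (mapComp g h).inv
  map₂_associator {a b c d : A} (f : a ⟶ b) (g : b ⟶ c) (h : c ⟶ d) :
    T.map₂ (Bicategory.associator f g h).hom = (mapComp (f ≫ g) h).hom ≫ (mapComp f g).hom ▷ T.map h ≫
      (Bicategory.associator (T.map f) (T.map g) (T.map h)).hom ≫ T.map f ◁ (mapComp g h).inv ≫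
      (mapComp f (g ≫ h)).inv
  map₂_left_unitor {a b : A} (f : a ⟶ b) :
    T.map₂ (Bicategory.leftUnitor f).hom = (mapComp (𝟙 a) f).hom ≫ (mapId a).hom ▷ T.map f ≫ (Bicategory.leftUnitor (T.map f)).hom
  map₂_right_unitor {a b : A} (f : a ⟶ b) :
    T.map₂ (Bicategory.rightUnitor f).hom = (mapComp f (𝟙 b)).hom ≫ T.map f ◁ (mapId b).hom ≫ (Bicategory.rightUnitor (T.map f)).hom

/-- The pseudofunctor with underlying action `T`. -/
abbrev PseudoExt.pseudo {A : Type u₂} [Bicategory.{w₂, v₂} A] {B : Type u₃}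
    [Bicategory.{w₃, v₃} B] {T : PrelaxFunctor A B} (E : PseudoExt T) : Pseudofunctor A B where
  toPrelaxFunctor := T
  mapId := E.mapId
  mapComp := E.mapComp
  map₂_whisker_left := E.map₂_whisker_left
  map₂_whisker_right := E.map₂_whisker_right
  map₂_associator := E.map₂_associator
  map₂_left_unitor := E.map₂_left_unitor
  map₂_right_unitor := E.map₂_right_unitor

/-- The product of two pseudofunctors. -/
def prodMap {A : Type u₁} [Bicategory.{w₁, v₁} A] {A' : Type u₂} [Bicategory.{w₂, v₂} A']
    {B : Type u₃} [Bicategory.{w₃, v₃} B] {B' : Type u₄} [Bicategory.{w₄, v₄} B']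
    (F : Pseudofunctor A A') (G : Pseudofunctor B B') : Pseudofunctor (A × B) (A' × B') where
  obj X := (F.obj X.1, G.obj X.2)
  map f := (F.map f.1, G.map f.2)
  map₂ η := (F.map₂ η.1, G.map₂ η.2)
  map₂_id f := Prod.ext (F.map₂_id _) (G.map₂_id _)
  map₂_comp η θ := Prod.ext (F.map₂_comp _ _) (G.map₂_comp _ _)
  mapId X := Iso.prod (F.mapId X.1) (G.mapId X.2)
  mapComp f g := Iso.prod (F.mapComp f.1 g.1) (G.mapComp f.2 g.2)
  map₂_whisker_left f _ _ η := Prod.ext (F.map₂_whisker_left _ _) (G.map₂_whisker_left _ _)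
  map₂_whisker_right η h := Prod.ext (F.map₂_whisker_right _ _) (G.map₂_whisker_right _ _)
  map₂_associator f g h := Prod.ext (F.map₂_associator _ _ _) (G.map₂_associator _ _ _)
  map₂_left_unitor f := Prod.ext (F.map₂_left_unitor _) (G.map₂_left_unitor _)
  map₂_right_unitor f := Prod.ext (F.map₂_right_unitor _) (G.map₂_right_unitor _)

/-- The rebracketing `(A × B) × C ⥤ A × (B × C)`. -/
def prodAssoc (A : Type u₁) [Bicategory.{w₁, v₁} A] (B : Type u₂) [Bicategory.{w₂, v₂} B]
    (C : Type u₃) [Bicategory.{w₃, v₃} C] : Pseudofunctor ((A × B) × C) (A × (B × C)) where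
  obj X := (X.1.1, (X.1.2, X.2))
  map f := (f.1.1, (f.1.2, f.2))
  map₂ η := (η.1.1, (η.1.2, η.2))
  map₂_id _ := rfl
  map₂_comp _ _ := rfl
  mapId _ := Iso.refl _
  mapComp _ _ := Iso.refl _
  map₂_whisker_left _ _ _ _ := by simp
  map₂_whisker_right _ _ := by simp
  map₂_associator _ _ _ := by simp
  map₂_left_unitor _ := by simp
  map₂_right_unitor _ := by simp

/-- A strong transformation is 2-natural (strict) if its naturality constraints are identities. -/
def IsStrictTrans {A : Type u₂} [Bicategory.{w₂, v₂} A] {B : Type u₃} [Bicategory.{w₃, v₃} B]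
    {F G : Pseudofunctor A B} (t : Pseudofunctor.StrongTrans F G) : Prop :=
  ∀ {a b : A} (f : a ⟶ b), ∃ h : F.map f ≫ t.app b = t.app a ≫ G.map f,
    t.naturality f = eqToIso h

/-- A 1-cell with a strict two-sided inverse. -/
def IsInvertible {B : Type u₂} [Bicategory.{w₂, v₂} B] {X Y : B} (f : X ⟶ Y) : Prop :=
  ∃ g : Y ⟶ X, f ≫ g = 𝟙 X ∧ g ≫ f = 𝟙 Y

/-- The structure of a nearly strict monoidal 2-category on the 2-category `B`, with product `T`
(on 0-, 1- and 2-cells) and unit object `J`. -/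
structure NearlyStrictMonoidal {B : Type u₂} [Bicategory.{w₂, v₂} B] [Bicategory.Strict B]
    (T : PrelaxFunctor (B × B) B) (J : B) where
  /-- The constraints making the product a pseudofunctor `B × B ⥤ B`. -/
  ext : PseudoExt T
  /-- The associator. -/
  a : Pseudofunctor.StrongTrans
    ((prodMap ext.pseudo (Pseudofunctor.id B)).comp ext.pseudo)
    ((prodAssoc B B B).comp ((prodMap (Pseudofunctor.id B) ext.pseudo).comp ext.pseudo))
  /-- The left unitor. -/
  l : Pseudofunctor.StrongTrans
    ((Bicategory.Prod.sectR J B).toPseudofunctor.comp ext.pseudo) (Pseudofunctor.id B)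
  /-- The right unitor. -/
  r : Pseudofunctor.StrongTrans
    ((Bicategory.Prod.sectL B J).toPseudofunctor.comp ext.pseudo) (Pseudofunctor.id B)
  a_strict : IsStrictTrans a
  l_strict : IsStrictTrans l
  r_strict : IsStrictTrans r
  a_inv (X Y Z : B) : IsInvertible (a.app ((X, Y), Z))
  l_inv (X : B) : IsInvertible (l.app X)
  r_inv (X : B) : IsInvertible (r.app X)
  pentagon (X Y Z Z' : B) :
    (T.map (X := (T.obj (T.obj (X, Y), Z), Z')) (Y := (T.obj (X, T.obj (Y, Z)), Z'))
        (a.app ((X, Y), Z), 𝟙 Z') ≫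
      (a.app ((X, T.obj (Y, Z)), Z') ≫
      T.map (X := (X, T.obj (T.obj (Y, Z), Z'))) (Y := (X, T.obj (Y, T.obj (Z, Z'))))
        (𝟙 X, a.app ((Y, Z), Z')) :
        T.obj (T.obj (X, T.obj (Y, Z)), Z') ⟶ T.obj (X, T.obj (Y, T.obj (Z, Z')))) :
      T.obj (T.obj (T.obj (X, Y), Z), Z') ⟶ T.obj (X, T.obj (Y, T.obj (Z, Z')))) =
    (a.app ((T.obj (X, Y), Z), Z') ≫ a.app ((X, Y), T.obj (Z, Z')) :
      T.obj (T.obj (T.obj (X, Y), Z), Z') ⟶ T.obj (X, T.obj (Y, T.obj (Z, Z'))))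
  triangle (X Y : B) :
    (a.app ((X, J), Y) ≫
      T.map (X := (X, T.obj (J, Y))) (Y := (X, Y)) (𝟙 X, l.app Y) :
      T.obj (T.obj (X, J), Y) ⟶ T.obj (X, Y)) =
    T.map (X := (T.obj (X, J), Y)) (Y := (X, Y)) (r.app X, 𝟙 Y)

/-- A symmetry on a nearly strict monoidal 2-category. -/
structure NearlyStrictSymmetry {B : Type u₂} [Bicategory.{w₂, v₂} B] [Bicategory.Strict B]
    {T : PrelaxFunctor (B × B) B} {J : B} (N : NearlyStrictMonoidal T J) where
  /-- The symmetry, natural up to invertible 2-cells. -/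
  s : Pseudofunctor.StrongTrans N.ext.pseudo
    ((Bicategory.Prod.swap B B).toPseudofunctor.comp N.ext.pseudo)
  s_comp_s (X Y : B) :
    (s.app (X, Y) ≫ s.app (Y, X) : T.obj (X, Y) ⟶ T.obj (X, Y)) = 𝟙 (T.obj (X, Y))
  hexagon (X Y Z : B) :
    (N.a.app ((X, Y), Z) ≫ (s.app (X, T.obj (Y, Z)) ≫ N.a.app ((Y, Z), X) :
        T.obj (X, T.obj (Y, Z)) ⟶ T.obj (Y, T.obj (Z, X))) :
      T.obj (T.obj (X, Y), Z) ⟶ T.obj (Y, T.obj (Z, X))) =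
    (T.map (X := (T.obj (X, Y), Z)) (Y := (T.obj (Y, X), Z)) (s.app (X, Y), 𝟙 Z) ≫
      (N.a.app ((Y, X), Z) ≫
      T.map (X := (Y, T.obj (X, Z))) (Y := (Y, T.obj (Z, X))) (𝟙 Y, s.app (X, Z)) :
        T.obj (T.obj (Y, X), Z) ⟶ T.obj (Y, T.obj (Z, X))) :
      T.obj (T.obj (X, Y), Z) ⟶ T.obj (Y, T.obj (Z, X)))
  s_unit (X : B) :
    (s.app (X, J) ≫ N.l.app X : T.obj (X, J) ⟶ X) = N.r.app X

end nearly

section para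

variable {V : Type u₁} [Category.{v₁} V] [MonoidalCategory V] [SymmetricCategory V]
  (M) (F : V ⥤ W) [F.LaxBraided] (P : ObjectProperty W) [IsStrictMonoidalSub P]

/-- The composite `V ⟶ W ⟶ Kl_M ⟶ Cat`. -/
abbrev paraFunctor : V ⥤ Cat.{v, max u v} := F ⋙ toKl M ⋙ partialSlice M P

/-- The change of base of the `V`-category `C` along `paraFunctor`, as a 2-category. -/
abbrev Para (C : Type w) [EnrichedCategory V C] :=
  CatEnriched (TransportEnrichment (paraFunctor M F P) C)

variable {C : Type w} [EnrichedCategory V C]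

/-- An object of `C` as a 0-cell. -/
def Para.of (X : C) : Para M F P C := X

variable {M F P}

/-- The 1-cell given by a Kleisli arrow `k : U ⟶ F C(X, Y)`. -/
def oneCell {X Y : C} (U : W) (hU : P U)
    (k : Kleisli.mk M U ⟶ (toKl M).obj (F.obj (X ⟶[V] Y))) :
    Para.of M F P X ⟶ Para.of M F P Y :=
  CostructuredArrow.mk (S := (klSub M P).ι)
    (Y := (⟨Kleisli.mk M U, hU⟩ : (klSub M P).FullSubcategory)) k

/-- The parameter space of a 1-cell. -/
def param {X Y : C} (f : Para.of M F P X ⟶ Para.of M F P Y) : W :=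
  (CostructuredArrow.left (S := (klSub M P).ι) (T := (toKl M).obj (F.obj (X ⟶[V] Y))) f).obj.of

theorem param_mem {X Y : C} (f : Para.of M F P X ⟶ Para.of M F P Y) : P (param f) :=
  (CostructuredArrow.left (S := (klSub M P).ι) (T := (toKl M).obj (F.obj (X ⟶[V] Y))) f).property

/-- The Kleisli arrow of a 1-cell. -/
def arrow {X Y : C} (f : Para.of M F P X ⟶ Para.of M F P Y) :
    Kleisli.mk M (param f) ⟶ (toKl M).obj (F.obj (X ⟶[V] Y)) :=
  CostructuredArrow.hom (S := (klSub M P).ι) (T := (toKl M).obj (F.obj (X ⟶[V] Y))) f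

/-- The reparametrization underlying a 2-cell. -/
def repar {X Y : C} {f g : Para.of M F P X ⟶ Para.of M F P Y} (φ : f ⟶ g) :
    Kleisli.mk M (param f) ⟶ Kleisli.mk M (param g) :=
  (CommaMorphism.left (L := (klSub M P).ι)
    (R := Functor.fromPUnit.{0} ((toKl M).obj (F.obj (X ⟶[V] Y)))) φ).hom

/-- The binary operation `(k₁ ⊗ k₂) ⨾ L_M(c)` on Kleisli arrows, where `c : A ⊗ B ⟶ D` in `W` and
`L_M(c) = c ⨾ η`. -/
def liftOp {U₁ U₂ A B D : W} (k₁ : Kleisli.mk M U₁ ⟶ (toKl M).obj A)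
    (k₂ : Kleisli.mk M U₂ ⟶ (toKl M).obj B) (c : A ⊗ B ⟶ D) :
    Kleisli.mk M (U₁ ⊗ U₂) ⟶ (toKl M).obj D :=
  MonoidalCategoryStruct.tensorHom k₁ k₂ ≫ (toKl M).map c

/-- The 1-cell `F_ε ⨾ F(p) ⨾ η` with parameter space `I` given by a point `p : I ⟶ C(X, Y)`. -/
def liftPt {X Y : C} (p : 𝟙_ V ⟶ (X ⟶[V] Y)) : Para.of M F P X ⟶ Para.of M F P Y :=
  oneCell (𝟙_ W) P.prop_unit ((toKl M).map (ε F ≫ F.map p))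

variable (M F P) in
/-- The product on 0-, 1- and 2-cells induced by a monoidal structure on the `V`-category `C`:
on hom-categories it is the functor `N C(X₁, Y₁) × N C(X₂, Y₂) ⟶ N (C(X₁, Y₁) ⊗ C(X₂, Y₂)) ⟶
N C(X₁ ⊠ X₂, Y₁ ⊠ Y₂)` for `N = paraFunctor M F P`. -/
def paraTensor (𝓜 : MonoidalVCat V C) :
    PrelaxFunctor (Para M F P C × Para M F P C) (Para M F P C) where
  obj X := Para.of M F P (𝓜.tensor X.1 X.2)
  map {X Y} f := (μ (paraFunctor M F P) _ _ ≫
    (paraFunctor M F P).map (𝓜.tensorHom X.1 Y.1 X.2 Y.2)).toFunctor.obj f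
  map₂ {X Y} _ _ η := (μ (paraFunctor M F P) _ _ ≫
    (paraFunctor M F P).map (𝓜.tensorHom X.1 Y.1 X.2 Y.2)).toFunctor.map η
  map₂_id {X Y} f := (μ (paraFunctor M F P) _ _ ≫
    (paraFunctor M F P).map (𝓜.tensorHom X.1 Y.1 X.2 Y.2)).toFunctor.map_id f
  map₂_comp {X Y} _ _ _ η θ := (μ (paraFunctor M F P) _ _ ≫
    (paraFunctor M F P).map (𝓜.tensorHom X.1 Y.1 X.2 Y.2)).toFunctor.map_comp η θ

end para

end ParaUncertainty

open ParaUncertainty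

/-!
A 2-cell of `Para_* C` is determined by its reparametrization, so an equation between 2-cells is an
equation in `Kl_M`; for the constraints below it is always a coherence law of symmetric monoidal
categories, with the middle-four interchange `tensorμ` as tensorator. On parameter spaces in `U` the
associators and unitors are identities, so 1-cells are equal as soon as their arrows agree along
such a constraint. This gives strictness, and it turns points of `C` into 1-cells with parameter
space `I` compatibly with composition and `⊠`, so that the pentagon, triangle, hexagon and unit
axioms are inherited from `C`.

A `V`-naturality square between points `p` and `q` lifts to a 2-cell `f ⨾ q ⇒ p ⨾ g` with
reparametrization `ρ ⨾ τ ⨾ λ⁻¹`, where `τ` compares the parameter spaces of `f` and `g`. For the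
associator and the unitors `τ` is an identity and the transformation is strictly natural; for the
symmetry `τ` is the swap of the parameter spaces.
-/

namespace ParaUncertainty

section coherence

variable {K : Type u} [Category.{v} K]

/-- The arrow `e` is an identity up to an equality of its endpoints. The constraints of a strict
structure have this property, and it is how equalities of 1-cells are detected. -/
def IsEqToHom {X Y : K} (e : X ⟶ Y) : Prop := ∃ h : X = Y, e = eqToHom h

theorem IsEqToHom.comp {X Y Z : K} {e : X ⟶ Y} {e' : Y ⟶ Z} (h : IsEqToHom e)
    (h' : IsEqToHom e') : IsEqToHom (e ≫ e') := by
  obtain ⟨rfl, rfl⟩ := h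
  obtain ⟨rfl, rfl⟩ := h'
  exact ⟨rfl, by simp⟩

theorem IsEqToHom.inv {X Y : K} {e : X ≅ Y} (h : IsEqToHom e.hom) : IsEqToHom e.inv := by
  obtain ⟨rfl, h⟩ := h
  exact ⟨rfl, (Iso.inv_eq_inv e (Iso.refl X)).2 h⟩

variable [MonoidalCategory K]

/-- The arrow `ρ ⨾ t ⨾ λ⁻¹`. It is the shape of a naturality constraint between 1-cells `f ⨾ p`
and `q ⨾ g` in which `p` and `q` have parameter space `I`. -/
abbrev unitConj {A B : K} (t : A ⟶ B) : A ⊗ 𝟙_ K ⟶ 𝟙_ K ⊗ B :=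
  (ρ_ A).hom ≫ t ≫ (λ_ B).inv

theorem unitConj_comp_whiskerLeft {A B A' B' D D' : K} {tA : A ⟶ A'} {tB : B ⟶ B'} {t : D ⟶ D'}
    {m : D ⟶ A ⊗ B} {m' : D' ⟶ A' ⊗ B'} (h : t ≫ m' = m ≫ (tA ⊗ₘ tB)) :
    unitConj t ≫ 𝟙_ K ◁ m' =
      m ▷ 𝟙_ K ≫ (α_ A B (𝟙_ K)).hom ≫ A ◁ unitConj tB ≫ (α_ A (𝟙_ K) B').inv ≫
        unitConj tA ▷ B' ≫ (α_ (𝟙_ K) A' B').hom := by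
  have naturality : unitConj t ≫ 𝟙_ K ◁ m' = (ρ_ D).hom ≫ (t ≫ m') ≫ (λ_ (A' ⊗ B')).inv := by
    simp
  rw [naturality, h, tensorHom_def']
  simp only [MonoidalCategory.whiskerLeft_comp, comp_whiskerRight, Category.assoc]
  monoidal

theorem unitConj_comp_whiskerLeft_unit {A A' : K} {t : A ⟶ A'} {i : A ⟶ 𝟙_ K} {i' : A' ⟶ 𝟙_ K}
    (h : t ≫ i' = i) :
    unitConj t ≫ 𝟙_ K ◁ i' = i ▷ 𝟙_ K ≫ (λ_ (𝟙_ K)).hom ≫ (ρ_ (𝟙_ K)).inv := by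
  subst h
  simp [unitors_equal, unitors_inv_equal]

theorem unitConj_natural {A A' B B' : K} {t : A ⟶ A'} {t' : B ⟶ B'} {x : A ⟶ B} {x' : A' ⟶ B'}
    (h : x ≫ t' = t ≫ x') : x ▷ 𝟙_ K ≫ unitConj t' = unitConj t ≫ 𝟙_ K ◁ x' := by
  rw [rightUnitor_naturality_assoc, reassoc_of% h]
  simp

-- The identity factors, here and in the coherence laws of `tensorμ`, are the constraints of the
-- strict factors of composite pseudofunctors.
theorem associator_comp_leftUnitor_leftUnitor :
    (α_ (𝟙_ K) (𝟙_ K) (𝟙_ K)).hom ≫ (𝟙 _ ⊗ₘ (𝟙 _ ⊗ₘ 𝟙 _)) ≫ (𝟙 _ ⊗ₘ (λ_ (𝟙_ K)).hom) ≫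
      (λ_ (𝟙_ K)).hom = ((λ_ (𝟙_ K)).hom ⊗ₘ 𝟙 _) ≫ (λ_ (𝟙_ K)).hom := by
  simp [unitors_equal]

end coherence

section symmetric

variable {K : Type u} [Category.{v} K] [MonoidalCategory K] [SymmetricCategory K]

theorem tensorμ_eq_tensorδ (X₁ X₂ Y₁ Y₂ : K) : tensorμ X₁ Y₁ X₂ Y₂ = tensorδ X₁ X₂ Y₁ Y₂ := by
  simp only [tensorμ, tensorδ, SymmetricCategory.braiding_swap_eq_inv_braiding X₂ Y₁]

/-- The middle-four interchange of a symmetric monoidal category. It is an involution, so its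
inverse is again an instance of `tensorμ`. -/
@[simps] def tensorμIso (X₁ X₂ Y₁ Y₂ : K) : (X₁ ⊗ X₂) ⊗ (Y₁ ⊗ Y₂) ≅ (X₁ ⊗ Y₁) ⊗ (X₂ ⊗ Y₂) where
  hom := tensorμ X₁ X₂ Y₁ Y₂
  inv := tensorμ X₁ Y₁ X₂ Y₂
  hom_inv_id := by rw [tensorμ_eq_tensorδ X₁ X₂, tensorμ_tensorδ]
  inv_hom_id := by rw [tensorμ_eq_tensorδ X₁ Y₁, tensorμ_tensorδ]

theorem whiskerLeft_tensorHom_whiskerLeft {A₁ B₁ A₂ B₂ : K} (U₁ U₂ : K) (x₁ : A₁ ⟶ B₁)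
    (x₂ : A₂ ⟶ B₂) :
    (U₁ ◁ x₁ ⊗ₘ U₂ ◁ x₂) =
      tensorμ U₁ A₁ U₂ A₂ ≫ (U₁ ⊗ U₂) ◁ (x₁ ⊗ₘ x₂) ≫ tensorμ U₁ U₂ B₁ B₂ := by
  rw [tensorμ_natural_right]
  exact ((tensorμIso U₁ A₁ U₂ A₂).hom_inv_id_assoc _).symm

theorem whiskerRight_tensorHom_whiskerRight {A₁ B₁ A₂ B₂ : K} (x₁ : A₁ ⟶ B₁) (x₂ : A₂ ⟶ B₂)
    (U₁ U₂ : K) :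
    (x₁ ▷ U₁ ⊗ₘ x₂ ▷ U₂) =
      tensorμ A₁ U₁ A₂ U₂ ≫ (x₁ ⊗ₘ x₂) ▷ (U₁ ⊗ U₂) ≫ tensorμ B₁ B₂ U₁ U₂ := by
  rw [tensorμ_natural_left]
  exact ((tensorμIso A₁ U₁ A₂ U₂).hom_inv_id_assoc _).symm

theorem associator_tensorHom_associator (X₁ Y₁ Z₁ X₂ Y₂ Z₂ : K) :
    ((α_ X₁ Y₁ Z₁).hom ⊗ₘ (α_ X₂ Y₂ Z₂).hom) =
      tensorμ (X₁ ⊗ Y₁) Z₁ (X₂ ⊗ Y₂) Z₂ ≫ tensorμ X₁ Y₁ X₂ Y₂ ▷ (Z₁ ⊗ Z₂) ≫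
        (α_ (X₁ ⊗ X₂) (Y₁ ⊗ Y₂) (Z₁ ⊗ Z₂)).hom ≫ (X₁ ⊗ X₂) ◁ tensorμ Y₁ Y₂ Z₁ Z₂ ≫
          tensorμ X₁ X₂ (Y₁ ⊗ Z₁) (Y₂ ⊗ Z₂) := by
  rw [← tensor_associativity, ← comp_whiskerRight_assoc,
    show tensorμ X₁ Y₁ X₂ Y₂ ≫ tensorμ X₁ X₂ Y₁ Y₂ = 𝟙 _ from (tensorμIso X₁ Y₁ X₂ Y₂).hom_inv_id,
    id_whiskerRight, Category.id_comp]
  exact ((tensorμIso (X₁ ⊗ Y₁) Z₁ (X₂ ⊗ Y₂) Z₂).hom_inv_id_assoc _).symm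

theorem braiding_tensorμ (X₁ Y₁ X₂ Y₂ : K) :
    (β_ (X₁ ⊗ Y₁) (X₂ ⊗ Y₂)).hom ≫ tensorμ X₂ Y₂ X₁ Y₁ =
      tensorμ X₁ Y₁ X₂ Y₂ ≫ ((β_ X₁ X₂).hom ⊗ₘ (β_ Y₁ Y₂).hom) := by
  have tensorμ_braiding : tensorμ X₁ X₂ Y₁ Y₂ ≫ (β_ (X₁ ⊗ Y₁) (X₂ ⊗ Y₂)).hom =
      ((β_ X₁ X₂).hom ⊗ₘ (β_ Y₁ Y₂).hom) ≫ tensorμ X₂ X₁ Y₂ Y₁ := by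
    simp [tensorμ, SymmetricCategory.braiding_swap_eq_inv_braiding X₂ Y₁,
      MonoidalCategory.tensorHom_def]
  exact (Iso.comp_inv_eq (tensorμIso X₂ X₁ Y₂ Y₁)).2 (by
    rw [Category.assoc]
    exact (Iso.eq_inv_comp (tensorμIso X₁ X₂ Y₁ Y₂)).2 tensorμ_braiding)

theorem associator_tensorμ_tensorμ (X₁ X₂ Y₁ Y₂ Z₁ Z₂ : K) :
    (α_ (X₁ ⊗ X₂) (Y₁ ⊗ Y₂) (Z₁ ⊗ Z₂)).hom ≫ (𝟙 _ ⊗ₘ (𝟙 _ ⊗ₘ 𝟙 _)) ≫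
        (𝟙 _ ⊗ₘ tensorμ Y₁ Y₂ Z₁ Z₂) ≫ tensorμ X₁ X₂ (Y₁ ⊗ Z₁) (Y₂ ⊗ Z₂) =
      ((tensorμ X₁ X₂ Y₁ Y₂ ⊗ₘ 𝟙 _) ≫ tensorμ (X₁ ⊗ Y₁) (X₂ ⊗ Y₂) Z₁ Z₂) ≫
        ((α_ X₁ Y₁ Z₁).hom ⊗ₘ (α_ X₂ Y₂ Z₂).hom) := by
  rw [id_tensorHom_id, id_tensorHom_id, Category.id_comp, tensorHom_id, id_tensorHom,
    Category.assoc, tensor_associativity]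

theorem leftUnitor_tensorHom_comp_id (X Y : K) :
    (λ_ (X ⊗ Y)).hom ≫ 𝟙 _ =
      (((ρ_ (𝟙_ K)).inv ⊗ₘ 𝟙 _) ≫ tensorμ (𝟙_ K) (𝟙_ K) X Y) ≫ ((λ_ X).hom ⊗ₘ (λ_ Y).hom) := by
  rw [Category.comp_id, tensor_left_unitality, tensorHom_id, unitors_inv_equal, Category.assoc]

theorem rightUnitor_tensorHom_comp_id (X Y : K) :
    (ρ_ (X ⊗ Y)).hom ≫ 𝟙 _ =
      ((𝟙 _ ⊗ₘ (λ_ (𝟙_ K)).inv) ≫ tensorμ X Y (𝟙_ K) (𝟙_ K)) ≫ ((ρ_ X).hom ⊗ₘ (ρ_ Y).hom) := by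
  rw [Category.comp_id, tensor_right_unitality, id_tensorHom, Category.assoc]

theorem braiding_comp_id_comp_tensorμ (X₁ Y₁ X₂ Y₂ : K) :
    (β_ (X₁ ⊗ Y₁) (X₂ ⊗ Y₂)).hom ≫ (𝟙 _ ⊗ₘ 𝟙 _) ≫ tensorμ X₂ Y₂ X₁ Y₁ =
      tensorμ X₁ Y₁ X₂ Y₂ ≫ ((β_ X₁ X₂).hom ⊗ₘ (β_ Y₁ Y₂).hom) := by
  rw [id_tensorHom_id, Category.id_comp, braiding_tensorμ]

theorem braiding_unit_comp_leftUnitor :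
    (β_ (𝟙_ K) (𝟙_ K)).hom ≫ (𝟙 _ ⊗ₘ 𝟙 _) ≫ (λ_ (𝟙_ K)).hom = (λ_ (𝟙_ K)).hom := by
  rw [id_tensorHom_id, Category.id_comp, braiding_leftUnitor, unitors_equal]

end symmetric

section laxMonoidal

variable {V : Type u₁} [Category.{v₁} V] [MonoidalCategory V]
  {K : Type u} [Category.{v} K] [MonoidalCategory K] (G : V ⥤ K)

section
variable [G.LaxMonoidal]

/-- The binary operation on generalized elements of `G A` and `G B` induced by `m : A ⊗ B ⟶ D`.
For `G = F ⨾ L_M` it is `liftOp` with `c = F̃ ⨾ F(m)`. -/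
def laxOp {U₁ U₂ : K} {A B D : V} (k₁ : U₁ ⟶ G.obj A) (k₂ : U₂ ⟶ G.obj B) (m : A ⊗ B ⟶ D) :
    U₁ ⊗ U₂ ⟶ G.obj D :=
  (k₁ ⊗ₘ k₂) ≫ μ G A B ≫ G.map m

/-- The point of `G D` induced by a point of `D`. -/
def laxPt {D : V} (p : 𝟙_ V ⟶ D) : 𝟙_ K ⟶ G.obj D := ε G ≫ G.map p

theorem laxOp_laxPt_left {U : K} {A B D : V} (p : 𝟙_ V ⟶ A) (k : U ⟶ G.obj B) (m : A ⊗ B ⟶ D) :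
    laxOp G (laxPt G p) k m = (λ_ U).hom ≫ k ≫ G.map ((λ_ B).inv ≫ p ▷ B ≫ m) := by
  rw [← leftUnitor_naturality_assoc, left_unitality]
  simp [laxOp, laxPt, MonoidalCategory.tensorHom_def', ← Functor.map_comp]

theorem laxOp_laxPt_right {U : K} {A B D : V} (k : U ⟶ G.obj A) (p : 𝟙_ V ⟶ B) (m : A ⊗ B ⟶ D) :
    laxOp G k (laxPt G p) m = (ρ_ U).hom ≫ k ≫ G.map ((ρ_ A).inv ≫ A ◁ p ≫ m) := by
  rw [← rightUnitor_naturality_assoc, right_unitality]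
  simp [laxOp, laxPt, MonoidalCategory.tensorHom_def, ← Functor.map_comp]

theorem laxOp_laxPt_laxPt {A B D : V} (p : 𝟙_ V ⟶ A) (q : 𝟙_ V ⟶ B) (m : A ⊗ B ⟶ D) :
    laxOp G (laxPt G p) (laxPt G q) m =
      (λ_ (𝟙_ K)).hom ≫ laxPt G ((λ_ (𝟙_ V)).inv ≫ (p ⊗ₘ q) ≫ m) := by
  rw [laxOp_laxPt_left]
  simp [laxPt, MonoidalCategory.tensorHom_def', ← Functor.map_comp]

theorem laxOp_eq_comp_map {U₁ U₂ : K} {A B D : V} (k₁ : U₁ ⟶ G.obj A) (k₂ : U₂ ⟶ G.obj B)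
    (m : A ⊗ B ⟶ D) : laxOp G k₁ k₂ m = laxOp G k₁ k₂ (𝟙 _) ≫ G.map m := by
  simp [laxOp]

theorem laxOp_laxOp_left {U₁ U₂ U₃ : K} {A B D E Z : V} (k₁ : U₁ ⟶ G.obj A) (k₂ : U₂ ⟶ G.obj B)
    (k₃ : U₃ ⟶ G.obj D) (m : A ⊗ B ⟶ E) (n : E ⊗ D ⟶ Z) :
    laxOp G (laxOp G k₁ k₂ m) k₃ n =
      laxOp G (laxOp G k₁ k₂ (𝟙 _)) k₃ (𝟙 _) ≫ G.map (m ▷ D ≫ n) := by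
  simp [laxOp, MonoidalCategory.tensorHom_def']

theorem associator_laxOp_laxOp_right {U₁ U₂ U₃ : K} {A B D E Z : V} (k₁ : U₁ ⟶ G.obj A)
    (k₂ : U₂ ⟶ G.obj B) (k₃ : U₃ ⟶ G.obj D) (m : B ⊗ D ⟶ E) (n : A ⊗ E ⟶ Z) :
    (α_ U₁ U₂ U₃).hom ≫ laxOp G k₁ (laxOp G k₂ k₃ m) n =
      laxOp G (laxOp G k₁ k₂ (𝟙 _)) k₃ (𝟙 _) ≫ G.map ((α_ A B D).hom ≫ A ◁ m ≫ n) := by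
  have right : k₁ ⊗ₘ ((k₂ ⊗ₘ k₃) ≫ μ G B D ≫ G.map m) =
      (k₁ ⊗ₘ (k₂ ⊗ₘ k₃)) ≫ _ ◁ μ G B D ≫ _ ◁ G.map m := by
    simp [MonoidalCategory.tensorHom_def]
  have left : ((k₁ ⊗ₘ k₂) ≫ μ G A B) ⊗ₘ k₃ = ((k₁ ⊗ₘ k₂) ⊗ₘ k₃) ≫ μ G A B ▷ _ := by
    simp [MonoidalCategory.tensorHom_def']
  simp only [laxOp, right, left, CategoryTheory.Functor.map_id, Category.comp_id, Functor.map_comp,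
    Category.assoc, μ_natural_right_assoc, ← associator_naturality_assoc, associativity_assoc]

end

variable [BraidedCategory V] [BraidedCategory K] [G.LaxBraided]

theorem braiding_laxOp {U₁ U₂ : K} {A B D : V} (k₁ : U₁ ⟶ G.obj A) (k₂ : U₂ ⟶ G.obj B)
    (m : B ⊗ A ⟶ D) :
    (β_ U₁ U₂).hom ≫ laxOp G k₂ k₁ m =
      laxOp G k₁ k₂ (𝟙 _) ≫ G.map ((β_ A B).hom ≫ m) := by
  simp only [laxOp, Functor.map_comp, CategoryTheory.Functor.map_id, Category.comp_id,
    Category.assoc, ← BraidedCategory.braiding_naturality_assoc, ← Functor.LaxBraided.braided_assoc]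

theorem laxOp_interchange {U₁ V₁ U₂ V₂ : K} {A₁ B₁ A₂ B₂ D₁ D₂ E₁ E₂ Z : V}
    (k₁ : U₁ ⟶ G.obj A₁) (l₁ : V₁ ⟶ G.obj B₁) (k₂ : U₂ ⟶ G.obj A₂) (l₂ : V₂ ⟶ G.obj B₂)
    {c₁ : A₁ ⊗ B₁ ⟶ D₁} {c₂ : A₂ ⊗ B₂ ⟶ D₂} {t : D₁ ⊗ D₂ ⟶ Z}
    {t₁ : A₁ ⊗ A₂ ⟶ E₁} {t₂ : B₁ ⊗ B₂ ⟶ E₂} {c : E₁ ⊗ E₂ ⟶ Z}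
    (h : tensorμ A₁ B₁ A₂ B₂ ≫ (t₁ ⊗ₘ t₂) ≫ c = (c₁ ⊗ₘ c₂) ≫ t) :
    laxOp G (laxOp G k₁ l₁ c₁) (laxOp G k₂ l₂ c₂) t =
      tensorμ U₁ V₁ U₂ V₂ ≫ laxOp G (laxOp G k₁ k₂ t₁) (laxOp G l₁ l₂ t₂) c := by
  have laxOp_laxOp_laxOp {X₁ Y₁ X₂ Y₂ : K} {P₁ Q₁ P₂ Q₂ R₁ R₂ S : V} (x₁ : X₁ ⟶ G.obj P₁)
      (y₁ : Y₁ ⟶ G.obj Q₁) (x₂ : X₂ ⟶ G.obj P₂) (y₂ : Y₂ ⟶ G.obj Q₂) (a : P₁ ⊗ Q₁ ⟶ R₁)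
      (b : P₂ ⊗ Q₂ ⟶ R₂) (d : R₁ ⊗ R₂ ⟶ S) :
      laxOp G (laxOp G x₁ y₁ a) (laxOp G x₂ y₂ b) d =
        ((x₁ ⊗ₘ y₁) ⊗ₘ (x₂ ⊗ₘ y₂)) ≫ (μ G P₁ Q₁ ⊗ₘ μ G P₂ Q₂) ≫ μ G _ _ ≫
          G.map ((a ⊗ₘ b) ≫ d) := by
    simp only [laxOp, Functor.map_comp, ← μ_natural_assoc, tensorHom_comp_tensorHom_assoc]
  rw [laxOp_laxOp_laxOp, laxOp_laxOp_laxOp, ← h, Functor.map_comp, ← tensorμ_natural_assoc]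
  congr 1
  simpa using (tensorμ_comp_μ_tensorHom_μ_comp_μ_assoc G A₁ B₁ A₂ B₂
    (G.map ((t₁ ⊗ₘ t₂) ≫ c))).symm

end laxMonoidal

section kleisli

variable {V : Type u₁} [Category.{v₁} V] [MonoidalCategory V]
  {W : Type u} [Category.{v} W] [MonoidalCategory W] [SymmetricCategory W]
  {M : Monad W} [M.toFunctor.LaxBraided] [NatTrans.IsMonoidal M.η] [NatTrans.IsMonoidal M.μ]
  {F : V ⥤ W} [F.LaxMonoidal]

theorem liftOp_eq_laxOp {U₁ U₂ : W} {A B D : V} (k₁ : Kleisli.mk M U₁ ⟶ (toKl M).obj (F.obj A))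
    (k₂ : Kleisli.mk M U₂ ⟶ (toKl M).obj (F.obj B)) (m : A ⊗ B ⟶ D) :
    liftOp k₁ k₂ (μ F A B ≫ F.map m) = laxOp (F ⋙ toKl M) k₁ k₂ m := by
  have μ_comp_toKl : μ (F ⋙ toKl M) A B = (toKl M).map (μ F A B) := Category.id_comp _
  rw [laxOp, μ_comp_toKl, liftOp, (toKl M).map_comp]
  rfl

theorem toKl_map_ε_comp_map {D : V} (p : 𝟙_ V ⟶ D) :
    (toKl M).map (ε F ≫ F.map p) = laxPt (F ⋙ toKl M) p := by
  have ε_comp_toKl : ε (F ⋙ toKl M) = (toKl M).map (ε F) := Category.id_comp _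
  rw [laxPt, ε_comp_toKl]
  exact (toKl M).map_comp _ _

theorem toKl_tensorμ (X₁ X₂ Y₁ Y₂ : W) :
    (toKl M).map (tensorμ X₁ X₂ Y₁ Y₂) =
      tensorμ (Kleisli.mk M X₁) (Kleisli.mk M X₂) (Kleisli.mk M Y₁) (Kleisli.mk M Y₂) := by
  have μ_id (A B A' B' : W) :
      (μ (toKl M) A B ⊗ₘ μ (toKl M) A' B') ≫ μ (toKl M) (A ⊗ B) (A' ⊗ B') = 𝟙 _ :=
    (Category.comp_id _).trans (id_tensorHom_id _ _)
  have naturality := tensorμ_comp_μ_tensorHom_μ_comp_μ (toKl M) X₁ X₂ Y₁ Y₂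
  rw [μ_id, ← Category.assoc, μ_id] at naturality
  exact ((Category.id_comp _).symm.trans naturality.symm).trans (Category.comp_id _)

end kleisli

section para

variable {V : Type u₁} [Category.{v₁} V] [MonoidalCategory V] [SymmetricCategory V]
  {W : Type u} [Category.{v} W] [MonoidalCategory W] [SymmetricCategory W]
  {M : Monad W} [M.toFunctor.LaxBraided] [NatTrans.IsMonoidal M.η] [NatTrans.IsMonoidal M.μ]
  {F : V ⥤ W} [F.LaxBraided] {P : ObjectProperty W} [IsStrictMonoidalSub P]
  {C : Type w} [EnrichedCategory V C]

/-- The hom-object of `C` between two 0-cells. It and the next four definitions restate the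
data of `Para M F P C` for 0-cells that are not presented as `Para.of X`. -/
abbrev homObj (X Y : Para M F P C) : V := EnrichedCategory.Hom (V := V) (C := C) X Y

/-- The parameter space of a 1-cell, as an object of `Kl_M`. -/
abbrev space {X Y : Para M F P C} (f : X ⟶ Y) : Kleisli M := Kleisli.mk M (param (C := C) f)

/-- The Kleisli arrow of a 1-cell. -/
abbrev arrowOf {X Y : Para M F P C} (f : X ⟶ Y) : space f ⟶ (F ⋙ toKl M).obj (homObj X Y) :=
  arrow (C := C) f

/-- The reparametrization underlying a 2-cell. -/
abbrev reparOf {X Y : Para M F P C} {f g : X ⟶ Y} (φ : f ⟶ g) : space f ⟶ space g :=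
  repar (C := C) φ

/-- The 1-cell with parameter space `I` given by a point. -/
abbrev ofPoint {X Y : Para M F P C} (p : 𝟙_ V ⟶ homObj X Y) : X ⟶ Y := liftPt (C := C) p

theorem space_mem {X Y : Para M F P C} (f : X ⟶ Y) : P (space f).of := param_mem (C := C) f

variable {X Y Z T : Para M F P C}

section twoCells

variable {f g : X ⟶ Y}

theorem reparOf_injective : Function.Injective (reparOf (f := f) (g := g)) := fun _ _ h =>
  CostructuredArrow.hom_ext _ _ (ObjectProperty.hom_ext _ h)

theorem arrowOf_eq_reparOf_comp (φ : f ⟶ g) : arrowOf f = reparOf φ ≫ arrowOf g :=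
  (CostructuredArrow.w φ).symm

/-- The 2-cell with underlying reparametrization `φ`. -/
def twoCell (φ : space f ⟶ space g) (h : arrowOf f = φ ≫ arrowOf g) : f ⟶ g :=
  CostructuredArrow.homMk (S := (klSub M P).ι) (T := (F ⋙ toKl M).obj (homObj X Y))
    (ObjectProperty.homMk φ) h.symm

theorem range_reparOf : Set.range (reparOf (f := f) (g := g)) = {φ | arrowOf f = φ ≫ arrowOf g} :=
  Set.ext fun φ => ⟨fun ⟨ψ, h⟩ => h ▸ arrowOf_eq_reparOf_comp ψ, fun h => ⟨twoCell φ h, rfl⟩⟩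

/-- The invertible 2-cell with underlying reparametrization `φ`. -/
def twoIso (φ : space f ≅ space g) (h : arrowOf f = φ.hom ≫ arrowOf g) : f ≅ g where
  hom := twoCell φ.hom h
  inv := twoCell φ.inv (by rw [h, Iso.inv_hom_id_assoc])
  hom_inv_id := reparOf_injective φ.hom_inv_id
  inv_hom_id := reparOf_injective φ.inv_hom_id

theorem reparOf_eqToHom (h : f = g) {e : space f ⟶ space g} (he : IsEqToHom e) :
    reparOf (eqToHom h) = e := by
  subst h
  exact he.choose_spec.symm

theorem oneCell_ext {e : space f ⟶ space g} (he : IsEqToHom e) (h : arrowOf f = e ≫ arrowOf g) :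
    f = g := by
  have eqToHom_hom (A B : (klSub M P).FullSubcategory) (h : A = B) (h' : A.obj = B.obj) :
      (eqToHom h).hom = eqToHom h' := by
    subst h; rfl
  obtain ⟨spaces_eq, e_eq⟩ := he
  have left_eq : CostructuredArrow.left (S := (klSub M P).ι) f =
      CostructuredArrow.left (S := (klSub M P).ι) g := ObjectProperty.FullSubcategory.ext spaces_eq
  refine CostructuredArrow.obj_ext (S := (klSub M P).ι) _ _ left_eq (Eq.trans ?_ h.symm)
  exact congrArg (· ≫ arrowOf g) ((eqToHom_hom _ _ left_eq spaces_eq).trans e_eq.symm)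

end twoCells

section twoCategory

theorem reparOf_id (f : X ⟶ Y) : reparOf (𝟙 f) = 𝟙 (space f) := rfl

theorem reparOf_comp {f g h : X ⟶ Y} (φ : f ⟶ g) (ψ : g ⟶ h) :
    reparOf (φ ≫ ψ) = reparOf φ ≫ reparOf ψ := rfl

theorem reparOf_whiskerLeft (f : X ⟶ Y) {g h : Y ⟶ Z} (φ : g ⟶ h) :
    reparOf (Bicategory.whiskerLeft f φ) = space f ◁ reparOf φ := rfl

theorem reparOf_whiskerRight {f g : X ⟶ Y} (φ : f ⟶ g) (h : Y ⟶ Z) :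
    reparOf (Bicategory.whiskerRight φ h) = reparOf φ ▷ space h := rfl

theorem reparOf_whiskerRight_comp_whiskerLeft {f₁ g₁ : X ⟶ Y} {f₂ g₂ : Y ⟶ Z} (φ₁ : f₁ ⟶ g₁)
    (φ₂ : f₂ ⟶ g₂) :
    reparOf (Bicategory.whiskerRight φ₁ f₂ ≫ Bicategory.whiskerLeft g₁ φ₂) =
      (reparOf φ₁ ⊗ₘ reparOf φ₂) := by
  rw [reparOf_comp, reparOf_whiskerRight, reparOf_whiskerLeft]
  exact (MonoidalCategory.tensorHom_def (reparOf φ₁) (reparOf φ₂)).symm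

theorem reparOf_associator_hom (f : X ⟶ Y) (g : Y ⟶ Z) (h : Z ⟶ T) :
    reparOf (Bicategory.associator f g h).hom = (α_ (space f) (space g) (space h)).hom :=
  reparOf_eqToHom (Category.assoc f g h)
    (kl_assoc M P _ _ _ (space_mem f) (space_mem g) (space_mem h))

theorem reparOf_associator_inv (f : X ⟶ Y) (g : Y ⟶ Z) (h : Z ⟶ T) :
    reparOf (Bicategory.associator f g h).inv = (α_ (space f) (space g) (space h)).inv :=
  reparOf_eqToHom (Category.assoc f g h).symm
    (IsEqToHom.inv (kl_assoc M P _ _ _ (space_mem f) (space_mem g) (space_mem h)))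

theorem reparOf_leftUnitor_hom (f : X ⟶ Y) :
    reparOf (Bicategory.leftUnitor f).hom = (λ_ (space f)).hom :=
  reparOf_eqToHom (Category.id_comp f) (kl_left M P _ (space_mem f))

theorem reparOf_leftUnitor_inv (f : X ⟶ Y) :
    reparOf (Bicategory.leftUnitor f).inv = (λ_ (space f)).inv :=
  reparOf_eqToHom (Category.id_comp f).symm (IsEqToHom.inv (kl_left M P _ (space_mem f)))

theorem reparOf_rightUnitor_hom (f : X ⟶ Y) :
    reparOf (Bicategory.rightUnitor f).hom = (ρ_ (space f)).hom :=
  reparOf_eqToHom (Category.comp_id f) (kl_right M P _ (space_mem f))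

theorem reparOf_rightUnitor_inv (f : X ⟶ Y) :
    reparOf (Bicategory.rightUnitor f).inv = (ρ_ (space f)).inv :=
  reparOf_eqToHom (Category.comp_id f).symm (IsEqToHom.inv (kl_right M P _ (space_mem f)))

theorem arrowOf_comp (f : X ⟶ Y) (g : Y ⟶ Z) :
    arrowOf (f ≫ g) =
      laxOp (F ⋙ toKl M) (arrowOf f) (arrowOf g) (eComp V (C := C) X Y Z) := by
  have unfolded : arrowOf (f ≫ g) = (((arrowOf f ⊗ₘ arrowOf g) ≫ 𝟙 _) ≫ (toKl M).map (μ F _ _)) ≫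
    (toKl M).map (F.map (eComp V (C := C) X Y Z)) := rfl
  rw [← liftOp_eq_laxOp, unfolded, liftOp, Category.comp_id, Category.assoc, (toKl M).map_comp]

theorem arrowOf_ofPoint (p : 𝟙_ V ⟶ homObj X Y) :
    arrowOf (ofPoint p) = laxPt (F ⋙ toKl M) p :=
  toKl_map_ε_comp_map p

theorem arrowOf_id (X : Para M F P C) :
    arrowOf (𝟙 X) = laxPt (F ⋙ toKl M) (eId V (C := C) X) := by
  have unfolded : arrowOf (𝟙 X) = ((𝟙 _ ≫ 𝟙 _) ≫ (toKl M).map (ε F)) ≫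
    (toKl M).map (F.map (eId V (C := C) X)) := rfl
  rw [unfolded, Category.comp_id, Category.id_comp, ← (toKl M).map_comp]
  exact toKl_map_ε_comp_map _

theorem arrowOf_comp_ofPoint {X' Y' : Para M F P C} {D : V} {Φ : D ⟶ homObj X Y}
    {Ψ : D ⟶ homObj X' Y'} {p : 𝟙_ V ⟶ homObj X X'} {q : 𝟙_ V ⟶ homObj Y Y'}
    (h : VNaturalAt (C := C) Φ Ψ p q) {f : X ⟶ Y} {g : X' ⟶ Y'}
    {k : space f ⟶ (F ⋙ toKl M).obj D} {τ : space f ⟶ space g}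
    (hf : arrowOf f = k ≫ (F ⋙ toKl M).map Φ) (hg : τ ≫ arrowOf g = k ≫ (F ⋙ toKl M).map Ψ) :
    arrowOf (f ≫ ofPoint q) = unitConj τ ≫ arrowOf (ofPoint p ≫ g) := by
  have square : Φ ≫ (ρ_ _).inv ≫ _ ◁ q ≫ eComp V (C := C) X Y Y' =
      Ψ ≫ (λ_ _).inv ≫ p ▷ _ ≫ eComp V (C := C) X X' Y' := by
    have square := h.symm
    rw [MonoidalCategory.tensorHom_def, tensorHom_def'] at square
    simpa using square
  rw [arrowOf_comp, arrowOf_comp, arrowOf_ofPoint, arrowOf_ofPoint]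
  refine (laxOp_laxPt_right _ _ _ _).trans (Eq.trans ?_
    (congrArg (_ ≫ ·) (laxOp_laxPt_left (F ⋙ toKl M) p (arrowOf g) _).symm))
  rw [hf, Category.assoc, Category.assoc, Category.assoc, Iso.inv_hom_id_assoc,
    ← Category.assoc τ, hg, Category.assoc, ← Functor.map_comp, ← Functor.map_comp, square]

end twoCategory

section points

theorem id_eq_liftPt (X : C) : 𝟙 (Para.of M F P X) = liftPt (eId V X) :=
  oneCell_ext (e := 𝟙 _) ⟨rfl, rfl⟩
    (((arrowOf_id _).trans (arrowOf_ofPoint _).symm).trans (Category.id_comp _).symm)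

variable {X Y Z : C}

theorem liftPt_comp_liftPt (p : 𝟙_ V ⟶ (X ⟶[V] Y)) (q : 𝟙_ V ⟶ (Y ⟶[V] Z)) :
    (liftPt p : Para.of M F P X ⟶ Para.of M F P Y) ≫
      (liftPt q : Para.of M F P Y ⟶ Para.of M F P Z) = liftPt (comp0 p q) := by
  refine oneCell_ext (kl_left M P (𝟙_ _) P.prop_unit) ?_
  refine (arrowOf_comp _ _).trans ?_
  refine (congrArg₂ (laxOp (F ⋙ toKl M) · · _) (arrowOf_ofPoint _) (arrowOf_ofPoint _)).trans ?_
  exact (laxOp_laxPt_laxPt _ p q _).trans (congrArg (_ ≫ ·) (arrowOf_ofPoint _).symm)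

theorem isInvertible_liftPt {p : 𝟙_ V ⟶ (X ⟶[V] Y)} (h : IsIso0 p) :
    IsInvertible (liftPt p : Para.of M F P X ⟶ Para.of M F P Y) := by
  obtain ⟨q, hpq, hqp⟩ := h
  exact ⟨liftPt q, by rw [liftPt_comp_liftPt, hpq, id_eq_liftPt],
    by rw [liftPt_comp_liftPt, hqp, id_eq_liftPt]⟩

end points


section tensor

variable (𝓜 : MonoidalVCat V C) {X₁ Y₁ Z₁ X₂ Y₂ Z₂ X₃ Y₃ : C}

/-- The product of two 1-cells. -/
abbrev tensor₁ (f₁ : Para.of M F P X₁ ⟶ Para.of M F P Y₁)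
    (f₂ : Para.of M F P X₂ ⟶ Para.of M F P Y₂) :
    Para.of M F P (𝓜.tensor X₁ X₂) ⟶ Para.of M F P (𝓜.tensor Y₁ Y₂) :=
  (paraTensor M F P 𝓜).map (X := (Para.of M F P X₁, Para.of M F P X₂))
    (Y := (Para.of M F P Y₁, Para.of M F P Y₂)) (f₁, f₂)

variable (f₁ : Para.of M F P X₁ ⟶ Para.of M F P Y₁) (f₂ : Para.of M F P X₂ ⟶ Para.of M F P Y₂)

theorem arrowOf_tensor₁ : arrowOf (tensor₁ 𝓜 f₁ f₂) =
    laxOp (F ⋙ toKl M) (arrowOf f₁) (arrowOf f₂) (𝓜.tensorHom X₁ Y₁ X₂ Y₂) := by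
  have unfolded : arrowOf (tensor₁ 𝓜 f₁ f₂) =
    (((arrowOf f₁ ⊗ₘ arrowOf f₂) ≫ 𝟙 _) ≫ (toKl M).map (μ F _ _)) ≫
      (toKl M).map (F.map (𝓜.tensorHom X₁ Y₁ X₂ Y₂)) := rfl
  rw [unfolded, Category.comp_id, Category.assoc, ← (toKl M).map_comp]
  exact liftOp_eq_laxOp _ _ _

theorem arrowOf_tensor₁_comp_comp (g₁ : Para.of M F P Y₁ ⟶ Para.of M F P Z₁)
    (g₂ : Para.of M F P Y₂ ⟶ Para.of M F P Z₂) :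
    arrowOf (tensor₁ 𝓜 (f₁ ≫ g₁) (f₂ ≫ g₂)) =
      tensorμ (space f₁) (space g₁) (space f₂) (space g₂) ≫
        arrowOf (tensor₁ 𝓜 f₁ f₂ ≫ tensor₁ 𝓜 g₁ g₂) := by
  rw [arrowOf_comp, arrowOf_tensor₁, arrowOf_tensor₁, arrowOf_tensor₁, arrowOf_comp, arrowOf_comp]
  exact laxOp_interchange _ _ _ _ _ (𝓜.tensorHom_comp X₁ Y₁ Z₁ X₂ Y₂ Z₂)

theorem arrowOf_tensor₁_liftPt_liftPt (p : 𝟙_ V ⟶ (X₁ ⟶[V] Y₁)) (q : 𝟙_ V ⟶ (X₂ ⟶[V] Y₂)) :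
    arrowOf (tensor₁ 𝓜 (liftPt p : Para.of M F P X₁ ⟶ Para.of M F P Y₁)
        (liftPt q : Para.of M F P X₂ ⟶ Para.of M F P Y₂)) =
      (λ_ (𝟙_ (Kleisli M))).hom ≫
        laxPt (F ⋙ toKl M) ((λ_ (𝟙_ V)).inv ≫ (p ⊗ₘ q) ≫ 𝓜.tensorHom X₁ Y₁ X₂ Y₂) :=
  (arrowOf_tensor₁ 𝓜 _ _).trans ((congrArg₂ (laxOp (F ⋙ toKl M) · · _) (arrowOf_ofPoint _)
    (arrowOf_ofPoint _)).trans (laxOp_laxPt_laxPt _ p q _))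

theorem tensor₁_liftPt_liftPt (p : 𝟙_ V ⟶ (X₁ ⟶[V] Y₁)) (q : 𝟙_ V ⟶ (X₂ ⟶[V] Y₂)) :
    tensor₁ 𝓜 (liftPt p : Para.of M F P X₁ ⟶ Para.of M F P Y₁)
        (liftPt q : Para.of M F P X₂ ⟶ Para.of M F P Y₂) =
      liftPt ((λ_ (𝟙_ V)).inv ≫ (p ⊗ₘ q) ≫ 𝓜.tensorHom X₁ Y₁ X₂ Y₂) :=
  oneCell_ext (kl_left M P (𝟙_ _) P.prop_unit) ((arrowOf_tensor₁_liftPt_liftPt 𝓜 p q).trans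
    (congrArg (_ ≫ ·) (arrowOf_ofPoint _).symm))

theorem arrowOf_tensor₁_id_id (X₁ X₂ : C) :
    arrowOf (tensor₁ 𝓜 (𝟙 (Para.of M F P X₁)) (𝟙 (Para.of M F P X₂))) =
      (λ_ (𝟙_ (Kleisli M))).hom ≫ arrowOf (𝟙 (Para.of M F P (𝓜.tensor X₁ X₂))) := by
  rw [arrowOf_tensor₁, arrowOf_id, arrowOf_id, arrowOf_id]
  exact (laxOp_laxPt_laxPt _ _ _ _).trans (congrArg (_ ≫ laxPt _ ·) (𝓜.tensorHom_id X₁ X₂))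

section coherence

variable (X Y Z T : C)

theorem pentagon_liftPt :
    tensor₁ 𝓜 (liftPt (𝓜.a X Y Z)) (𝟙 (Para.of M F P T)) ≫ liftPt (𝓜.a X (𝓜.tensor Y Z) T) ≫
      tensor₁ 𝓜 (𝟙 (Para.of M F P X)) (liftPt (𝓜.a Y Z T)) =
    liftPt (𝓜.a (𝓜.tensor X Y) Z T) ≫ liftPt (𝓜.a X Y (𝓜.tensor Z T)) := by
  simp only [id_eq_liftPt, tensor₁_liftPt_liftPt, liftPt_comp_liftPt, 𝓜.pentagon]

theorem triangle_liftPt :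
    liftPt (𝓜.a X 𝓜.unit Y) ≫ tensor₁ 𝓜 (𝟙 (Para.of M F P X)) (liftPt (𝓜.l Y)) =
      tensor₁ 𝓜 (liftPt (𝓜.r X)) (𝟙 (Para.of M F P Y)) := by
  simp only [id_eq_liftPt, tensor₁_liftPt_liftPt, liftPt_comp_liftPt, 𝓜.triangle]

variable {𝓜} (𝓢 : SymmetryVCat 𝓜)

theorem symmetry_comp_symmetry_liftPt :
    (liftPt (𝓢.s X Y) : Para.of M F P (𝓜.tensor X Y) ⟶ Para.of M F P (𝓜.tensor Y X)) ≫
      liftPt (𝓢.s Y X) = 𝟙 (Para.of M F P (𝓜.tensor X Y)) := by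
  simp only [id_eq_liftPt, liftPt_comp_liftPt, 𝓢.s_comp_s]

theorem hexagon_liftPt :
    liftPt (𝓜.a X Y Z) ≫ liftPt (𝓢.s X (𝓜.tensor Y Z)) ≫ liftPt (𝓜.a Y Z X) =
      tensor₁ 𝓜 (liftPt (𝓢.s X Y)) (𝟙 (Para.of M F P Z)) ≫ liftPt (𝓜.a Y X Z) ≫
        tensor₁ 𝓜 (𝟙 (Para.of M F P Y)) (liftPt (𝓢.s X Z)) := by
  simp only [id_eq_liftPt, tensor₁_liftPt_liftPt, liftPt_comp_liftPt, 𝓢.hexagon]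

theorem symmetry_comp_leftUnitor_liftPt :
    (liftPt (𝓢.s X 𝓜.unit) : Para.of M F P (𝓜.tensor X 𝓜.unit) ⟶ _) ≫
      (liftPt (𝓜.l X) : _ ⟶ Para.of M F P X) = liftPt (𝓜.r X) := by
  simp only [liftPt_comp_liftPt, 𝓢.s_unit]

end coherence

section naturality

theorem arrowOf_tensor₁_comp_associator (f₃ : Para.of M F P X₃ ⟶ Para.of M F P Y₃) :
    arrowOf (tensor₁ 𝓜 (tensor₁ 𝓜 f₁ f₂) f₃ ≫ liftPt (𝓜.a Y₁ Y₂ Y₃)) =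
      unitConj (α_ (space f₁) (space f₂) (space f₃)).hom ≫
        arrowOf (liftPt (𝓜.a X₁ X₂ X₃) ≫ tensor₁ 𝓜 f₁ (tensor₁ 𝓜 f₂ f₃)) := by
  have left_bracketed : arrowOf (tensor₁ 𝓜 (tensor₁ 𝓜 f₁ f₂) f₃) =
      laxOp _ (laxOp _ (arrowOf f₁) (arrowOf f₂) (𝟙 _)) (arrowOf f₃) (𝟙 _) ≫ (F ⋙ toKl M).map
        (𝓜.tensorHom X₁ Y₁ X₂ Y₂ ▷ _ ≫ 𝓜.tensorHom _ _ X₃ Y₃) := by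
    rw [arrowOf_tensor₁, arrowOf_tensor₁]
    exact laxOp_laxOp_left _ _ _ _ _ _
  have right_bracketed : (α_ _ _ _).hom ≫ arrowOf (tensor₁ 𝓜 f₁ (tensor₁ 𝓜 f₂ f₃)) =
      laxOp _ (laxOp _ (arrowOf f₁) (arrowOf f₂) (𝟙 _)) (arrowOf f₃) (𝟙 _) ≫ (F ⋙ toKl M).map
        ((α_ _ _ _).hom ≫ _ ◁ 𝓜.tensorHom X₂ Y₂ X₃ Y₃ ≫ 𝓜.tensorHom X₁ Y₁ _ _) := by
    rw [arrowOf_tensor₁, arrowOf_tensor₁]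
    exact associator_laxOp_laxOp_right _ _ _ _ _ _
  exact arrowOf_comp_ofPoint (𝓜.a_natural X₁ Y₁ X₂ Y₂ X₃ Y₃) left_bracketed right_bracketed

theorem arrowOf_tensor₁_id_comp_leftUnitor :
    arrowOf (tensor₁ 𝓜 (𝟙 (Para.of M F P 𝓜.unit)) f₁ ≫ liftPt (𝓜.l Y₁)) =
      unitConj (λ_ (space f₁)).hom ≫ arrowOf (liftPt (𝓜.l X₁) ≫ f₁) := by
  have unit_tensor : arrowOf (tensor₁ 𝓜 (𝟙 (Para.of M F P 𝓜.unit)) f₁) =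
      ((λ_ (space f₁)).hom ≫ arrowOf f₁) ≫ (F ⋙ toKl M).map
        ((λ_ _).inv ≫ eId V 𝓜.unit ▷ _ ≫ 𝓜.tensorHom 𝓜.unit 𝓜.unit X₁ Y₁) := by
    rw [arrowOf_tensor₁, arrowOf_id]
    exact (laxOp_laxPt_left _ _ _ _).trans (Category.assoc _ _ _).symm
  exact arrowOf_comp_ofPoint (𝓜.l_natural X₁ Y₁) unit_tensor
    ((congrArg (_ ≫ ·) (CategoryTheory.Functor.map_id _ _)).trans (Category.comp_id _)).symm

theorem arrowOf_tensor₁_id_comp_rightUnitor :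
    arrowOf (tensor₁ 𝓜 f₁ (𝟙 (Para.of M F P 𝓜.unit)) ≫ liftPt (𝓜.r Y₁)) =
      unitConj (ρ_ (space f₁)).hom ≫ arrowOf (liftPt (𝓜.r X₁) ≫ f₁) := by
  have tensor_unit : arrowOf (tensor₁ 𝓜 f₁ (𝟙 (Para.of M F P 𝓜.unit))) =
      ((ρ_ (space f₁)).hom ≫ arrowOf f₁) ≫ (F ⋙ toKl M).map
        ((ρ_ _).inv ≫ _ ◁ eId V 𝓜.unit ≫ 𝓜.tensorHom X₁ Y₁ 𝓜.unit 𝓜.unit) := by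
    rw [arrowOf_tensor₁, arrowOf_id]
    exact (laxOp_laxPt_right _ _ _ _).trans (Category.assoc _ _ _).symm
  exact arrowOf_comp_ofPoint (𝓜.r_natural X₁ Y₁) tensor_unit
    ((congrArg (_ ≫ ·) (CategoryTheory.Functor.map_id _ _)).trans (Category.comp_id _)).symm

theorem arrowOf_tensor₁_comp_symmetry {𝓜 : MonoidalVCat V C} (𝓢 : SymmetryVCat 𝓜) :
    arrowOf (tensor₁ 𝓜 f₁ f₂ ≫ liftPt (𝓢.s Y₁ Y₂)) =
      unitConj (β_ (space f₁) (space f₂)).hom ≫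
        arrowOf (liftPt (𝓢.s X₁ X₂) ≫ tensor₁ 𝓜 f₂ f₁) := by
  have unswapped : arrowOf (tensor₁ 𝓜 f₁ f₂) =
      laxOp _ (arrowOf f₁) (arrowOf f₂) (𝟙 _) ≫ (F ⋙ toKl M).map (𝓜.tensorHom X₁ Y₁ X₂ Y₂) := by
    rw [arrowOf_tensor₁]
    exact laxOp_eq_comp_map _ _ _ _
  have swapped : (β_ _ _).hom ≫ arrowOf (tensor₁ 𝓜 f₂ f₁) =
      laxOp _ (arrowOf f₁) (arrowOf f₂) (𝟙 _) ≫ (F ⋙ toKl M).map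
        ((β_ _ _).hom ≫ 𝓜.tensorHom X₂ Y₂ X₁ Y₁) := by
    rw [arrowOf_tensor₁]
    exact braiding_laxOp _ _ _ _
  exact arrowOf_comp_ofPoint (𝓢.s_natural X₁ Y₁ X₂ Y₂) unswapped swapped

end naturality

end tensor

section pseudofunctor

variable (𝓜 : MonoidalVCat V C)

/-- The composition constraint of the product, which is the inverse of the tensorator `ϑ`. -/
def tensorComp {X₁ Y₁ Z₁ X₂ Y₂ Z₂ : C}
    (f₁ : Para.of M F P X₁ ⟶ Para.of M F P Y₁) (f₂ : Para.of M F P X₂ ⟶ Para.of M F P Y₂)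
    (g₁ : Para.of M F P Y₁ ⟶ Para.of M F P Z₁) (g₂ : Para.of M F P Y₂ ⟶ Para.of M F P Z₂) :
    tensor₁ 𝓜 (f₁ ≫ g₁) (f₂ ≫ g₂) ≅ tensor₁ 𝓜 f₁ f₂ ≫ tensor₁ 𝓜 g₁ g₂ :=
  twoIso (tensorμIso (space f₁) (space g₁) (space f₂) (space g₂))
    (arrowOf_tensor₁_comp_comp 𝓜 f₁ f₂ g₁ g₂)

/-- The unit constraint of the product. -/
def tensorId (X₁ X₂ : C) :
    tensor₁ 𝓜 (𝟙 (Para.of M F P X₁)) (𝟙 (Para.of M F P X₂)) ≅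
      𝟙 (Para.of M F P (𝓜.tensor X₁ X₂)) :=
  twoIso (λ_ (𝟙_ (Kleisli M))) (arrowOf_tensor₁_id_id 𝓜 X₁ X₂)

variable (M F P) in
/-- The constraints that make the product of `Para_* C` a pseudofunctor. -/
def tensorExt : PseudoExt (paraTensor M F P 𝓜) where
  mapId X := tensorId 𝓜 X.1 X.2
  mapComp f g := tensorComp 𝓜 f.1 f.2 g.1 g.2
  map₂_whisker_left f _ _ η := reparOf_injective
    (whiskerLeft_tensorHom_whiskerLeft (space f.1) (space f.2) (reparOf η.1) (reparOf η.2))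
  map₂_whisker_right η h := reparOf_injective
    (whiskerRight_tensorHom_whiskerRight (reparOf η.1) (reparOf η.2) (space h.1) (space h.2))
  map₂_associator f g h := reparOf_injective (by
    refine (congrArg₂ (· ⊗ₘ ·) (reparOf_associator_hom f.1 g.1 h.1)
      (reparOf_associator_hom f.2 g.2 h.2)).trans
        ((associator_tensorHom_associator _ _ _ _ _ _).trans ?_)
    exact congrArg (tensorμ (space f.1 ⊗ space g.1) _ _ _ ≫ tensorμ _ _ _ _ ▷ _ ≫ · ≫
      _ ◁ tensorμ _ _ _ _ ≫ tensorμ _ _ _ _) (reparOf_associator_hom (tensor₁ 𝓜 f.1 f.2)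
        (tensor₁ 𝓜 g.1 g.2) (tensor₁ 𝓜 h.1 h.2)).symm)
  map₂_left_unitor f := reparOf_injective (by
    refine (congrArg₂ (· ⊗ₘ ·) (reparOf_leftUnitor_hom f.1) (reparOf_leftUnitor_hom f.2)).trans
      ((leftUnitor_monoidal _ _).trans ?_)
    exact congrArg (tensorμ (𝟙_ (Kleisli M)) _ _ _ ≫ (λ_ (𝟙_ (Kleisli M))).hom ▷ _ ≫ ·)
      (reparOf_leftUnitor_hom (tensor₁ 𝓜 f.1 f.2)).symm)
  map₂_right_unitor f := reparOf_injective (by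
    refine (congrArg₂ (· ⊗ₘ ·) (reparOf_rightUnitor_hom f.1) (reparOf_rightUnitor_hom f.2)).trans
      ((rightUnitor_monoidal _ _).trans ?_)
    exact congrArg (tensorμ _ (𝟙_ (Kleisli M)) _ _ ≫ _ ◁ (λ_ (𝟙_ (Kleisli M))).hom ≫ ·)
      (reparOf_rightUnitor_hom (tensor₁ 𝓜 f.1 f.2)).symm)

end pseudofunctor

/-- A family of points `p` of `C` and of isomorphisms `τ` between parameter spaces which satisfy
the conditions under which `p` lifts to a strong transformation with naturality constraints
`ρ ⨾ τ ⨾ λ⁻¹`. -/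
structure PointTrans {A : Type u₂} [Bicategory.{w₂, v₂} A]
    (Φ Ψ : Pseudofunctor A (Para M F P C)) where
  pt (a : A) : 𝟙_ V ⟶ homObj (Φ.obj a) (Ψ.obj a)
  τ {a b : A} (f : a ⟶ b) : space (Φ.map f) ≅ space (Ψ.map f)
  arrowOf_comp_ofPoint {a b : A} (f : a ⟶ b) :
    arrowOf (Φ.map f ≫ ofPoint (pt b)) = unitConj (τ f).hom ≫ arrowOf (ofPoint (pt a) ≫ Ψ.map f)
  τ_natural {a b : A} {f g : a ⟶ b} (η : f ⟶ g) :
    reparOf (Φ.map₂ η) ≫ (τ g).hom = (τ f).hom ≫ reparOf (Ψ.map₂ η)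
  τ_id (a : A) : (τ (𝟙 a)).hom ≫ reparOf (Ψ.mapId a).hom = reparOf (Φ.mapId a).hom
  τ_comp {a b c : A} (f : a ⟶ b) (g : b ⟶ c) :
    (τ (f ≫ g)).hom ≫ reparOf (Ψ.mapComp f g).hom =
      reparOf (Φ.mapComp f g).hom ≫ ((τ f).hom ⊗ₘ (τ g).hom)

namespace PointTrans

variable {A : Type u₂} [Bicategory.{w₂, v₂} A] {Φ Ψ : Pseudofunctor A (Para M F P C)}

/-- The strong transformation with the given points as components. -/
def strongTrans (t : PointTrans Φ Ψ) : Pseudofunctor.StrongTrans Φ Ψ where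
  app a := ofPoint (t.pt a)
  naturality f := twoIso (ρ_ _ ≪≫ t.τ f ≪≫ (λ_ _).symm) (t.arrowOf_comp_ofPoint f)
  naturality_naturality η := reparOf_injective (unitConj_natural (t.τ_natural η))
  naturality_id a := reparOf_injective (by
    refine (unitConj_comp_whiskerLeft_unit (t.τ_id a)).trans ?_
    exact congrArg₂ (_ ▷ _ ≫ · ≫ ·) (reparOf_leftUnitor_hom (ofPoint (t.pt a))).symm
      (reparOf_rightUnitor_inv (ofPoint (t.pt a))).symm)
  naturality_comp f g := reparOf_injective (by
    refine (unitConj_comp_whiskerLeft (t.τ_comp f g)).trans ?_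
    exact congr (congr (congrArg (_ ▷ _ ≫ · ≫ _ ◁ _ ≫ · ≫ _ ▷ _ ≫ ·)
      (reparOf_associator_hom (Φ.map f) (Φ.map g) (ofPoint (t.pt _))).symm)
      (reparOf_associator_inv (Φ.map f) (ofPoint (t.pt _)) (Ψ.map g)).symm)
      (reparOf_associator_hom (ofPoint (t.pt _)) (Ψ.map f) (Ψ.map g)).symm)

theorem isStrictTrans (t : PointTrans Φ Ψ)
    (h : ∀ {a b : A} (f : a ⟶ b), IsEqToHom (t.τ f).hom) :
    IsStrictTrans t.strongTrans := fun f => by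
  have constraint_isEqToHom : IsEqToHom (unitConj (t.τ f).hom) :=
    (show IsEqToHom _ from kl_right M P _ (space_mem (Φ.map f))).comp
      ((h f).comp (IsEqToHom.inv (kl_left M P _ (space_mem (Ψ.map f)))))
  have square := oneCell_ext constraint_isEqToHom (t.arrowOf_comp_ofPoint f)
  exact ⟨square, Iso.ext (reparOf_injective (reparOf_eqToHom square constraint_isEqToHom).symm)⟩

end PointTrans

section monoidal

variable (M F P) (𝓜 : MonoidalVCat V C)

/-- The points of `C` that underlie the associator of `Para_* C`. -/
def associatorPoints : PointTrans (C := C)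
    ((prodMap (tensorExt M F P 𝓜).pseudo (Pseudofunctor.id _)).comp (tensorExt M F P 𝓜).pseudo)
    ((prodAssoc _ _ _).comp ((prodMap (Pseudofunctor.id _) (tensorExt M F P 𝓜).pseudo).comp
      (tensorExt M F P 𝓜).pseudo)) where
  pt X := 𝓜.a X.1.1 X.1.2 X.2
  τ f := α_ (space f.1.1) (space f.1.2) (space f.2)
  arrowOf_comp_ofPoint f := arrowOf_tensor₁_comp_associator 𝓜 f.1.1 f.1.2 f.2
  τ_natural η := associator_naturality (reparOf η.1.1) (reparOf η.1.2) (reparOf η.2)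
  τ_id _ := associator_comp_leftUnitor_leftUnitor
  τ_comp f g := associator_tensorμ_tensorμ (space f.1.1) (space g.1.1) (space f.1.2)
    (space g.1.2) (space f.2) (space g.2)

/-- The points of `C` that underlie the left unitor of `Para_* C`. -/
def leftUnitorPoints : PointTrans (C := C)
    ((Bicategory.Prod.sectR (Para.of M F P 𝓜.unit) _).toPseudofunctor.comp
      (tensorExt M F P 𝓜).pseudo) (Pseudofunctor.id _) where
  pt X := 𝓜.l X
  τ f := λ_ (space f)
  arrowOf_comp_ofPoint f := arrowOf_tensor₁_id_comp_leftUnitor 𝓜 f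
  τ_natural η := leftUnitor_naturality (reparOf η)
  τ_id _ := show (λ_ (𝟙_ (Kleisli M))).hom ≫ 𝟙 _ = (𝟙 _ ⊗ₘ 𝟙 _) ≫ (λ_ (𝟙_ (Kleisli M))).hom by
    simp
  τ_comp f g := (leftUnitor_tensorHom_comp_id (space f) (space g)).trans
    (congrArg (fun x => ((x ⊗ₘ 𝟙 _) ≫ _) ≫ _)
      (reparOf_rightUnitor_inv (𝟙 (Para.of M F P 𝓜.unit))).symm)

/-- The points of `C` that underlie the right unitor of `Para_* C`. -/
def rightUnitorPoints : PointTrans (C := C)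
    ((Bicategory.Prod.sectL _ (Para.of M F P 𝓜.unit)).toPseudofunctor.comp
      (tensorExt M F P 𝓜).pseudo) (Pseudofunctor.id _) where
  pt X := 𝓜.r X
  τ f := ρ_ (space f)
  arrowOf_comp_ofPoint f := arrowOf_tensor₁_id_comp_rightUnitor 𝓜 f
  τ_natural η := rightUnitor_naturality (reparOf η)
  τ_id _ := show (ρ_ (𝟙_ (Kleisli M))).hom ≫ 𝟙 _ = (𝟙 _ ⊗ₘ 𝟙 _) ≫ (λ_ (𝟙_ (Kleisli M))).hom by
    simp [unitors_equal]
  τ_comp f g := (rightUnitor_tensorHom_comp_id (space f) (space g)).trans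
    (congrArg (fun x => ((𝟙 _ ⊗ₘ x) ≫ _) ≫ _)
      (reparOf_leftUnitor_inv (𝟙 (Para.of M F P 𝓜.unit))).symm)

/-- The nearly strict monoidal structure of `Para_* C`. -/
def paraMonoidal : NearlyStrictMonoidal (paraTensor M F P 𝓜) (Para.of M F P 𝓜.unit) where
  ext := tensorExt M F P 𝓜
  a := (associatorPoints M F P 𝓜).strongTrans
  l := (leftUnitorPoints M F P 𝓜).strongTrans
  r := (rightUnitorPoints M F P 𝓜).strongTrans
  a_strict := (associatorPoints M F P 𝓜).isStrictTrans fun f =>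
    kl_assoc M P _ _ _ (space_mem f.1.1) (space_mem f.1.2) (space_mem f.2)
  l_strict := (leftUnitorPoints M F P 𝓜).isStrictTrans fun f => kl_left M P _ (space_mem f)
  r_strict := (rightUnitorPoints M F P 𝓜).isStrictTrans fun f => kl_right M P _ (space_mem f)
  a_inv X Y Z := isInvertible_liftPt (C := C) (𝓜.a_iso X Y Z)
  l_inv X := isInvertible_liftPt (C := C) (𝓜.l_iso X)
  r_inv X := isInvertible_liftPt (C := C) (𝓜.r_iso X)
  pentagon X Y Z T := pentagon_liftPt 𝓜 X Y Z T
  triangle X Y := triangle_liftPt 𝓜 X Y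

variable {𝓜} (𝓢 : SymmetryVCat 𝓜)

/-- The points of `C` that underlie the symmetry of `Para_* C`. -/
def symmetryPoints : PointTrans (C := C) (tensorExt M F P 𝓜).pseudo
    ((Bicategory.Prod.swap _ _).toPseudofunctor.comp (tensorExt M F P 𝓜).pseudo) where
  pt X := 𝓢.s X.1 X.2
  τ f := β_ (space f.1) (space f.2)
  arrowOf_comp_ofPoint f := arrowOf_tensor₁_comp_symmetry (C := C) f.1 f.2 𝓢
  τ_natural η := BraidedCategory.braiding_naturality (reparOf η.1) (reparOf η.2)
  τ_id _ := braiding_unit_comp_leftUnitor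
  τ_comp f g := braiding_comp_id_comp_tensorμ (space f.1) (space g.1) (space f.2) (space g.2)

/-- The symmetry of the nearly strict monoidal structure of `Para_* C`. -/
def paraSymmetry : NearlyStrictSymmetry (paraMonoidal M F P 𝓜) where
  s := (symmetryPoints M F P 𝓢).strongTrans
  s_comp_s X Y := symmetry_comp_symmetry_liftPt (C := C) X Y 𝓢
  hexagon X Y Z := hexagon_liftPt (C := C) X Y Z 𝓢
  s_unit X := symmetry_comp_leftUnitor_liftPt (C := C) X 𝓢

end monoidal

section explicit

variable {X Y Z X₁ Y₁ Z₁ X₂ Y₂ Z₂ : C}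

theorem oneCell_bijective (X Y : C) : Function.Bijective
    (fun k : (Σ U : {U : W // P U}, (Kleisli.mk M U.1 ⟶ (toKl M).obj (F.obj (X ⟶[V] Y)))) =>
      (oneCell k.1.1 k.1.2 k.2 : Para.of M F P X ⟶ Para.of M F P Y)) :=
  Function.bijective_iff_has_inverse.2
    ⟨fun f => ⟨⟨param f, param_mem f⟩, arrow f⟩, fun _ => rfl, fun _ => rfl⟩

theorem comp_eq_oneCell (f : Para.of M F P X ⟶ Para.of M F P Y)
    (g : Para.of M F P Y ⟶ Para.of M F P Z) :
    f ≫ g = oneCell (param f ⊗ param g) (P.prop_tensor (param_mem f) (param_mem g))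
      (liftOp (arrow f) (arrow g) (μ F _ _ ≫ F.map (eComp V X Y Z))) :=
  oneCell_ext (e := 𝟙 _) ⟨rfl, rfl⟩ ((arrowOf_comp f g).trans
    ((liftOp_eq_laxOp _ _ _).symm.trans (Category.id_comp _).symm))

theorem tensor₁_eq_oneCell (𝓜 : MonoidalVCat V C) (f₁ : Para.of M F P X₁ ⟶ Para.of M F P Y₁)
    (f₂ : Para.of M F P X₂ ⟶ Para.of M F P Y₂) :
    tensor₁ 𝓜 f₁ f₂ = oneCell (param f₁ ⊗ param f₂)
      (P.prop_tensor (param_mem f₁) (param_mem f₂))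
      (liftOp (arrow f₁) (arrow f₂) (μ F _ _ ≫ F.map (𝓜.tensorHom X₁ Y₁ X₂ Y₂))) :=
  oneCell_ext (e := 𝟙 _) ⟨rfl, rfl⟩ ((arrowOf_tensor₁ 𝓜 f₁ f₂).trans
    ((liftOp_eq_laxOp _ _ _).symm.trans (Category.id_comp _).symm))

theorem repar_tensorComp_inv (𝓜 : MonoidalVCat V C)
    (f₁ : Para.of M F P X₁ ⟶ Para.of M F P Y₁) (f₂ : Para.of M F P X₂ ⟶ Para.of M F P Y₂)
    (g₁ : Para.of M F P Y₁ ⟶ Para.of M F P Z₁) (g₂ : Para.of M F P Y₂ ⟶ Para.of M F P Z₂) :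
    repar (tensorComp 𝓜 f₁ f₂ g₁ g₂).inv =
      (toKl M).map (tensorμ (param f₁) (param f₂) (param g₁) (param g₂)) :=
  (toKl_tensorμ _ _ _ _).symm

theorem exists_unitConj_toKl_map_eq {A B : W} (hA : P A) (hB : P B) (t : A ⟶ B) :
    ∃ h₁ h₂, unitConj ((toKl M).map t) = eqToHom h₁ ≫ (toKl M).map t ≫ eqToHom h₂ := by
  obtain ⟨h₁, right_eq⟩ := kl_right M P (Kleisli.mk M A) hA
  obtain ⟨h₂, left_inv_eq⟩ := IsEqToHom.inv (kl_left M P (Kleisli.mk M B) hB)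
  exact ⟨h₁, h₂, congrArg₂ (· ≫ (toKl M).map t ≫ ·) right_eq left_inv_eq⟩

end explicit

end para

end ParaUncertainty

theorem mainTheorem1
    {V : Type u₁} [Category.{v₁} V] [MonoidalCategory V] [SymmetricCategory V]
    {W : Type u} [Category.{v} W] [MonoidalCategory W] [SymmetricCategory W]
    (M : Monad W) [M.toFunctor.LaxBraided] [NatTrans.IsMonoidal M.η] [NatTrans.IsMonoidal M.μ]
    (F : V ⥤ W) [F.LaxBraided] (P : ObjectProperty W) [IsStrictMonoidalSub P]
    {C : Type w} [EnrichedCategory V C] :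
    -- the result of the change of base is a (strict) 2-category
    Bicategory.Strict (Para M F P C) ∧
    -- (i) 0-cells
    Function.Bijective (fun X : C => Para.of M F P X) ∧
    -- (ii) 1-cells
    (∀ X Y : C, Function.Bijective
      (fun k : (Σ U : {U : W // P U}, (Kleisli.mk M U.1 ⟶ (toKl M).obj (F.obj (X ⟶[V] Y)))) =>
        (oneCell k.1.1 k.1.2 k.2 : Para.of M F P X ⟶ Para.of M F P Y))) ∧
    (∀ (X Y : C) (f : Para.of M F P X ⟶ Para.of M F P Y),
      f = oneCell (param f) (param_mem f) (arrow f)) ∧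
    -- (iii) 2-cells and their vertical composition
    (∀ (X Y : C) (f g : Para.of M F P X ⟶ Para.of M F P Y),
      Function.Injective (fun φ : f ⟶ g => repar φ) ∧
      Set.range (fun φ : f ⟶ g => repar φ) = {φ | arrow f = φ ≫ arrow g}) ∧
    (∀ (X Y : C) (f : Para.of M F P X ⟶ Para.of M F P Y), repar (𝟙 f) = 𝟙 _) ∧
    (∀ (X Y : C) (f g h : Para.of M F P X ⟶ Para.of M F P Y) (φ : f ⟶ g) (ψ : g ⟶ h),
      repar (φ ≫ ψ) = repar φ ≫ repar ψ) ∧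
    -- (iv) identities and horizontal composition
    (∀ X : C, 𝟙 (Para.of M F P X) = liftPt (eId V X)) ∧
    (∀ (X Y Z : C) (f : Para.of M F P X ⟶ Para.of M F P Y)
      (g : Para.of M F P Y ⟶ Para.of M F P Z),
      f ≫ g = oneCell (param f ⊗ param g) (P.prop_tensor (param_mem f) (param_mem g))
        (liftOp (arrow f) (arrow g) (μ F _ _ ≫ F.map (eComp V X Y Z)))) ∧
    (∀ (X Y Z : C) (f₁ g₁ : Para.of M F P X ⟶ Para.of M F P Y)
      (f₂ g₂ : Para.of M F P Y ⟶ Para.of M F P Z) (φ₁ : f₁ ⟶ g₁) (φ₂ : f₂ ⟶ g₂),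
      repar (Bicategory.whiskerRight φ₁ f₂ ≫ Bicategory.whiskerLeft g₁ φ₂) =
        MonoidalCategoryStruct.tensorHom (repar φ₁) (repar φ₂)) ∧
    -- (v) the monoidal structure
    (∀ 𝓜 : MonoidalVCat V C,
      (∀ X Y : C, (paraTensor M F P 𝓜).obj (Para.of M F P X, Para.of M F P Y) =
        Para.of M F P (𝓜.tensor X Y)) ∧
      (∀ (X₁ Y₁ X₂ Y₂ : C) (f₁ : Para.of M F P X₁ ⟶ Para.of M F P Y₁)
        (f₂ : Para.of M F P X₂ ⟶ Para.of M F P Y₂),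
        (paraTensor M F P 𝓜).map (X := (Para.of M F P X₁, Para.of M F P X₂))
            (Y := (Para.of M F P Y₁, Para.of M F P Y₂)) (f₁, f₂) =
          oneCell (param f₁ ⊗ param f₂) (P.prop_tensor (param_mem f₁) (param_mem f₂))
            (liftOp (arrow f₁) (arrow f₂) (μ F _ _ ≫ F.map (𝓜.tensorHom X₁ Y₁ X₂ Y₂)))) ∧
      (∀ (X₁ Y₁ X₂ Y₂ : C) (f₁ g₁ : Para.of M F P X₁ ⟶ Para.of M F P Y₁)
        (f₂ g₂ : Para.of M F P X₂ ⟶ Para.of M F P Y₂) (φ₁ : f₁ ⟶ g₁) (φ₂ : f₂ ⟶ g₂),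
        repar (X := 𝓜.tensor X₁ X₂) (Y := 𝓜.tensor Y₁ Y₂)
            ((paraTensor M F P 𝓜).map₂ (a := (Para.of M F P X₁, Para.of M F P X₂))
              (b := (Para.of M F P Y₁, Para.of M F P Y₂)) (f := (f₁, f₂)) (g := (g₁, g₂))
              (φ₁, φ₂)) =
          MonoidalCategoryStruct.tensorHom (repar φ₁) (repar φ₂)) ∧
      ∃ N : NearlyStrictMonoidal (paraTensor M F P 𝓜) (Para.of M F P 𝓜.unit),
        -- tensorators
        (∀ (X₁ Y₁ Z₁ X₂ Y₂ Z₂ : C)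
          (f₁ : Para.of M F P X₁ ⟶ Para.of M F P Y₁) (f₂ : Para.of M F P X₂ ⟶ Para.of M F P Y₂)
          (g₁ : Para.of M F P Y₁ ⟶ Para.of M F P Z₁) (g₂ : Para.of M F P Y₂ ⟶ Para.of M F P Z₂),
          repar (X := 𝓜.tensor X₁ X₂) (Y := 𝓜.tensor Z₁ Z₂)
              (N.ext.mapComp (a := (Para.of M F P X₁, Para.of M F P X₂))
                (b := (Para.of M F P Y₁, Para.of M F P Y₂))
                (c := (Para.of M F P Z₁, Para.of M F P Z₂)) (f₁, f₂) (g₁, g₂)).inv =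
            (toKl M).map (tensorμ (param f₁) (param f₂) (param g₁) (param g₂))) ∧
        (∀ X₁ X₂ : C,
          repar (X := 𝓜.tensor X₁ X₂) (Y := 𝓜.tensor X₁ X₂)
              (N.ext.mapId (Para.of M F P X₁, Para.of M F P X₂)).hom =
            (toKl M).map (λ_ (𝟙_ W)).hom) ∧
        -- coherence 1-cells
        (∀ X Y Z : C, N.a.app ((Para.of M F P X, Para.of M F P Y), Para.of M F P Z) =
          liftPt (𝓜.a X Y Z)) ∧
        (∀ X : C, N.l.app (Para.of M F P X) = liftPt (𝓜.l X)) ∧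
        (∀ X : C, N.r.app (Para.of M F P X) = liftPt (𝓜.r X)) ∧
        -- the symmetric case
        (∀ 𝓢 : SymmetryVCat 𝓜, ∃ S : NearlyStrictSymmetry N,
          (∀ X Y : C, S.s.app (Para.of M F P X, Para.of M F P Y) = liftPt (𝓢.s X Y)) ∧
          (∀ (X₁ Y₁ X₂ Y₂ : C) (f₁ : Para.of M F P X₁ ⟶ Para.of M F P Y₁)
            (f₂ : Para.of M F P X₂ ⟶ Para.of M F P Y₂),
            ∃ h₁ h₂, repar (X := 𝓜.tensor X₁ X₂) (Y := 𝓜.tensor Y₂ Y₁)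
                (S.s.naturality (a := (Para.of M F P X₁, Para.of M F P X₂))
                  (b := (Para.of M F P Y₁, Para.of M F P Y₂)) (f₁, f₂)).hom =
              eqToHom h₁ ≫ (toKl M).map (β_ (param f₁) (param f₂)).hom ≫ eqToHom h₂))) := by
  refine ⟨inferInstance, Function.bijective_id, oneCell_bijective, fun _ _ _ => rfl,
    fun _ _ _ _ => ⟨reparOf_injective, range_reparOf⟩, fun _ _ f => reparOf_id f,
    fun _ _ _ _ _ φ ψ => reparOf_comp φ ψ, id_eq_liftPt, fun _ _ _ => comp_eq_oneCell,
    fun _ _ _ _ _ _ _ => reparOf_whiskerRight_comp_whiskerLeft, fun 𝓜 => ?_⟩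
  refine ⟨fun _ _ => rfl, fun _ _ _ _ => tensor₁_eq_oneCell 𝓜, fun _ _ _ _ _ _ _ _ _ _ => rfl,
    paraMonoidal M F P 𝓜, fun _ _ _ _ _ _ => repar_tensorComp_inv 𝓜, fun _ _ => rfl,
    fun _ _ _ => rfl, fun _ => rfl, fun _ => rfl, fun 𝓢 => ?_⟩
  refine ⟨paraSymmetry M F P 𝓢, fun _ _ => rfl, fun _ _ _ _ f₁ f₂ => ?_⟩
  exact exists_unitConj_toKl_map_eq (P := P) (P.prop_tensor (param_mem f₁) (param_mem f₂))
    (P.prop_tensor (param_mem f₂) (param_mem f₁)) (β_ (param f₁) (param f₂)).hom
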